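/- Let $\mathrm{Li}_2(w)=-\int_0^1\frac{\log(1-tw)}{t}\,dt$ ($w\in\mathbb C\setminus[1,\infty)$) be the principal branch of Euler's dilogarithm, equal to $\sum_{k\ge1}w^k/k^2$ for $|w|<1$. For $b>0$, $w\in\mathbb C$ with $|\mathrm{Im}\,w|<\tfrac12(b+b^{-1})$ and $0<\epsilon<\pi\min(b,b^{-1})$, let Faddeev's quantum dilogarithm be $$\Phi_b(w)=\exp\left(\int_{\mathbb R+i\epsilon}\frac{e^{-2ixw}}{4\sinh(xb)\sinh(xb^{-1})}\frac{dx}{x}\right),$$ and let $\log\Phi_b(w)$ denote the integral in the exponent. For $z\in\mathbb C$ with $|\mathrm{Im}\,z|<\pi$ consider the formal power series in $\tau$ $$\hat\phi_\tau(z)=\sum_{n=1}^\infty(2\pi i)^{2n-1}\frac{B_{2n}(1/2)}{(2n)!}\,\partial_z^{2n}\mathrm{Li}_2(-e^z)\,\tau^{2n-1},$$ where $B_{2n}(1/2)$ is the value at $1/2$ of the $2n$-th Bernoulli polynomial. For a series $\varphi\in\tau\,\mathbb C[[\tau]]$, its Borel transform is the series in $\xi$ obtained by $\tau^{n+1}\mapsto\xi^n/n!$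 ($n\ge0$). We say that $\varphi$ is Borel summable at $\tau>0$ with Borel sum $s$ if its Borel transform has positive radius of convergence, continues analytically to a function $G$ on $S_\delta=\{\xi\in\mathbb C:\mathrm{dist}(\xi,[0,\infty))<\delta\}$ for some $\delta>0$, and the Laplace integral $\int_0^\infty e^{-\xi/\tau}G(\xi)\,d\xi$ converges absolutely and equals $s$. Let $\tau>0$, $b=\sqrt\tau$ and $z\in\mathbb C$ with $|\mathrm{Im}\,z|<\pi$. Then the integral defining $\log\Phi_b\left(\frac{z}{2\pi b}\right)$ converges absolutely for every $0<\epsilon<\pi\min(b,b^{-1})$, the series $\hat\phi_\tau(z)$ is Borel summable at $\tau$, and its Borel sum $L$ satisfies, for every such $\epsilon$, $$\log\Phi_b\left(\frac{z}{2\pi b}\right)=\frac{1}{2\pi i\tau}\,\mathrm{Li}_2(-e^z)+L,$$ and hence $\Phi_b\left(\frac{z}{2\pi b}\right)=\exp\left(\frac{1}{2\pi i\tau}\mathrm{Li}_2(-e^z)+L\right)$. -/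

import Mathlib

noncomputable section

namespace QuantumDilog

/-- Euler's dilogarithm, principal branch on `ℂ \ [1, ∞)`:
`Li₂(w) = - ∫₀¹ log (1 - t w) / t dt`, with the principal logarithm.  For `‖w‖ < 1` it is the sum
of the series `∑_{k ≥ 1} w ^ k / k ^ 2` (proved in `hasSum_Li2` below). -/
def Li2 (w : ℂ) : ℂ :=
  -∫ t in (0 : ℝ)..1, Complex.log (1 - (t : ℂ) * w) / (t : ℂ)

/-- The number `B_k(1/2)`, the `k`-th Bernoulli polynomial evaluated at `1/2`. -/
def bernoulliHalf (k : ℕ) : ℚ := (Polynomial.bernoulli k).eval (1 / 2)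

/-- The formal power series in `τ`
`∑_{n ≥ 1} (2πi)^(2n-1) * B_{2n}(1/2) / (2n)! * ∂_z^{2n} Li₂(-e^z) * τ^(2n-1)`.
The coefficient of `τ^k` is the term with `2n - 1 = k` for odd `k`, and zero for even `k`. -/
def phiHat (z : ℂ) : PowerSeries ℂ :=
  PowerSeries.mk fun k =>
    if Odd k then
      (2 * Real.pi * Complex.I) ^ k * ((bernoulliHalf (k + 1) : ℚ) : ℂ) / ((k + 1).factorial : ℂ)
        * iteratedDeriv (k + 1) (fun w : ℂ => Li2 (-Complex.exp w)) z
    else 0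

/-- The formal Borel transform `τ^(n+1) ↦ ξ^n / n!`. It is used only for series without constant
term. -/
def borelTransform (φ : PowerSeries ℂ) : PowerSeries ℂ :=
  PowerSeries.mk fun n => PowerSeries.coeff (n + 1) φ / (n.factorial : ℂ)

/-- The half-line `[0, ∞)` inside `ℂ`. -/
def halfLine : Set ℂ := (fun t : ℝ => (t : ℂ)) '' Set.Ici 0

/-- `S_δ = {ξ | dist(ξ, [0, ∞)) < δ}`. -/
def halfStrip (δ : ℝ) : Set ℂ := Metric.thickening δ halfLine

/-- `s` is the Borel sum at `τ > 0` of the formal power series `φ ∈ τ ℂ[[τ]]`: the Borel transform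
of `φ` has a positive radius of convergence, its sum continues analytically to a function `G` on
some `S_δ`, and the Laplace integral `∫₀^∞ e^(-ξ/τ) G(ξ) dξ` converges absolutely and equals `s`.
The number `s` is determined by `φ` and `τ` (`IsBorelSum.unique` below). -/
def IsBorelSum (φ : PowerSeries ℂ) (τ : ℝ) (s : ℂ) : Prop :=
  PowerSeries.constantCoeff φ = 0 ∧
  ∃ (G : ℂ → ℂ) (δ : ℝ), 0 < δ ∧
    HasFPowerSeriesAt G
      (FormalMultilinearSeries.ofScalars ℂ fun n => PowerSeries.coeff n (borelTransform φ)) 0 ∧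
    AnalyticOnNhd ℂ G (halfStrip δ) ∧
    MeasureTheory.IntegrableOn (fun ξ : ℝ => Complex.exp (-(ξ : ℂ) / (τ : ℂ)) * G ξ) (Set.Ioi 0) ∧
    s = ∫ ξ : ℝ in Set.Ioi 0, Complex.exp (-(ξ : ℂ) / (τ : ℂ)) * G ξ

/-- The integrand `e^(-2ixw) / (4 sinh(x b) sinh(x / b) x)` of Faddeev's integral. -/
def faddeevIntegrand (b : ℝ) (w x : ℂ) : ℂ :=
  Complex.exp (-2 * Complex.I * x * w) /
    (4 * Complex.sinh (x * (b : ℂ)) * Complex.sinh (x * (b : ℂ)⁻¹) * x)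

/-- `log Φ_b(w)`: the integral of `faddeevIntegrand b w` along the line `ℝ + iε`. -/
def logFaddeev (b ε : ℝ) (w : ℂ) : ℂ :=
  ∫ x : ℝ, faddeevIntegrand b w ((x : ℂ) + (ε : ℂ) * Complex.I)

/-- Faddeev's quantum dilogarithm `Φ_b(w) = exp (∫_{ℝ + iε} …)`. -/
def faddeevPhi (b ε : ℝ) (w : ℂ) : ℂ := Complex.exp (logFaddeev b ε w)

theorem hasSum_Li2 {w : ℂ} (hw : ‖w‖ < 1) :
    HasSum (fun k : ℕ => w ^ (k + 1) / ((k : ℂ) + 1) ^ 2) (Li2 w) := by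
  have hterm : ∀ k : ℕ, (∫ t in (0 : ℝ)..1, (t : ℂ) ^ k * (w ^ (k + 1) / ((k : ℂ) + 1)))
      = w ^ (k + 1) / ((k : ℂ) + 1) ^ 2 := by
    intro k
    have hk : ((k : ℂ) + 1) ≠ 0 := Nat.cast_add_one_ne_zero k
    have h1 : (∫ t in (0 : ℝ)..1, (t : ℂ) ^ k) = 1 / ((k : ℂ) + 1) := by
      have h2 : (∫ t in (0 : ℝ)..1, (t : ℂ) ^ k) = ((∫ t in (0 : ℝ)..1, t ^ k : ℝ) : ℂ) := by
        rw [← intervalIntegral.integral_ofReal]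
        simp
      rw [h2, integral_pow]
      simp
    rw [intervalIntegral.integral_mul_const, h1]
    field_simp
  have key := intervalIntegral.hasSum_integral_of_dominated_convergence
    (μ := MeasureTheory.volume) (a := 0) (b := 1)
    (F := fun (k : ℕ) (t : ℝ) => (t : ℂ) ^ k * (w ^ (k + 1) / ((k : ℂ) + 1)))
    (f := fun t : ℝ => -(Complex.log (1 - (t : ℂ) * w) / (t : ℂ)))
    (fun k _ => ‖w‖ ^ k)
    (fun k => (by fun_prop : Continuous _).aestronglyMeasurable)
    (fun k => Filter.Eventually.of_forall fun t ht => ?_)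
    (Filter.Eventually.of_forall fun t _ => summable_geometric_of_lt_one (norm_nonneg w) hw)
    (by simp) (Filter.Eventually.of_forall fun t ht => ?_)
  · simp only [hterm, intervalIntegral.integral_neg] at key
    exact key
  · rw [Set.uIoc_of_le zero_le_one] at ht
    have h1 : ‖(t : ℂ)‖ ^ k ≤ 1 := by
      rw [Complex.norm_real, Real.norm_of_nonneg ht.1.le]
      exact pow_le_one₀ ht.1.le ht.2
    have h2 : ‖(k : ℂ) + 1‖ = (k : ℝ) + 1 := by
      have := Complex.norm_natCast (k + 1)
      push_cast at this
      exact this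
    rw [norm_mul, norm_pow, norm_div, norm_pow, h2, pow_succ]
    have h3 : ‖w‖ ^ k * ‖w‖ / ((k : ℝ) + 1) ≤ ‖w‖ ^ k := by
      rw [div_le_iff₀ (by positivity)]
      have h4 : (0 : ℝ) ≤ ‖w‖ ^ k := by positivity
      exact mul_le_mul_of_nonneg_left (by linarith [(Nat.cast_nonneg k : (0 : ℝ) ≤ k)]) h4
    calc _ ≤ 1 * (‖w‖ ^ k * ‖w‖ / ((k : ℝ) + 1)) :=
          mul_le_mul_of_nonneg_right h1 (by positivity)
      _ ≤ _ := by rw [one_mul]; exact h3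
  · rw [Set.uIoc_of_le zero_le_one] at ht
    have ht0 : (t : ℂ) ≠ 0 := by exact_mod_cast ht.1.ne'
    have hn : ‖(t : ℂ) * w‖ < 1 := by
      rw [norm_mul, Complex.norm_real, Real.norm_of_nonneg ht.1.le]
      nlinarith [norm_nonneg w, ht.1, ht.2]
    have h := Complex.hasSum_taylorSeries_neg_log hn
    rw [← hasSum_nat_add_iff' 1] at h
    have h' := h.div_const (t : ℂ)
    simp only [Finset.range_one, Finset.sum_singleton, pow_zero, Nat.cast_zero, div_zero,
      sub_zero, neg_div] at h'
    refine (congrArg (fun g : ℕ → ℂ => HasSum g _) (funext fun k => ?_)).mp h'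
    push_cast
    have hk : ((k : ℂ) + 1) ≠ 0 := Nat.cast_add_one_ne_zero k
    field_simp
    ring

theorem IsBorelSum.unique {φ : PowerSeries ℂ} {τ : ℝ} {s s' : ℂ}
    (h : IsBorelSum φ τ s) (h' : IsBorelSum φ τ s') : s = s' := by
  obtain ⟨-, G, δ, hδ, hG, hA, -, rfl⟩ := h
  obtain ⟨-, G', δ', hδ', hG', hA', -, rfl⟩ := h'
  have hconv : Convex ℝ halfLine := by
    have h := (convex_Ici (0 : ℝ)).linear_image Complex.ofRealCLM.toLinearMap
    exact h
  have h0 : (0 : ℂ) ∈ halfLine := ⟨0, Set.self_mem_Ici, by simp⟩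
  set d := min δ δ' with hd
  have hdpos : 0 < d := lt_min hδ hδ'
  have heq : Set.EqOn G G' (halfStrip d) := by
    refine (hA.mono (Metric.thickening_mono (min_le_left _ _) _)).eqOn_of_preconnected_of_eventuallyEq
      (hA'.mono (Metric.thickening_mono (min_le_right _ _) _))
      (hconv.thickening d).isPreconnected (Metric.self_subset_thickening hdpos _ h0) ?_
    filter_upwards [hG.eventually_hasSum_sub, hG'.eventually_hasSum_sub] with y hy hy'
    exact hy.unique hy'
  refine MeasureTheory.setIntegral_congr_fun measurableSet_Ioi fun ξ hξ => ?_
  have : G ξ = G' ξ :=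
    heq (Metric.self_subset_thickening hdpos _ ⟨ξ, Set.mem_Ici.2 (Set.mem_Ioi.1 hξ).le, rfl⟩)
  simp only [this]

end QuantumDilog

end

noncomputable section

open MeasureTheory Filter Topology Set

namespace QuantumDilog

/-! Write σ(w) = 1/(1 + e^(-w)), so that ∂²Li₂(-e^w) = -σ(w). After the substitution x = by,
Faddeev's integral becomes the integral of e^(-iyz/π) / (4y sinh y sinh(τy)) over a line ℝ + iv with
0 < v < π and τv < π. Both sides of the theorem are compared through the partial fractions
(`hasSum_one_div_sinh`) 1/sinh(τy) = 1/(τy) + ∑_{n≥1} (-1)^n 2τy / (τ²y² + π²n²).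

The link is the Fourier integral `integral_expDivSinh`: up to a constant, σ(w) is the integral of
e^(-iyw/π)/sinh y over the line. Integrating σ(z + cs) against a weight in s > 0 therefore
multiplies the line integrand by a Laplace transform of the weight (`integral_mul_logistic`). The
weight s with c = -1 produces 1/y², and since Li₂(-e^z) = -∫₀^∞ s σ(z - s) ds, the term 1/(τy)
contributes exactly Li₂(-e^z)/(2πiτ). The weight e^(-s/τ) with c = ±1/n produces two simple
fractions whose sum is the n-th partial fraction (`laplace_borelTerm`).

Hence the remainder is the Laplace integral of G(ξ) = (1/2πi) ∑_{n≥1} (-1)^n n^(-2) (σ(z + ξ/n) +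
σ(z - ξ/n)). This G is holomorphic for |Im ξ| < π - |Im z| and bounded on the real axis. Its Taylor
coefficients at 0 contain the alternating zeta values ∑ (-1)^n n^(-2m-2), which are multiples of
B_{2m+2}(1/2); so G continues the Borel transform of `phiHat z` (`hasFPowerSeriesAt_borelFun`). The
two termwise computations meet in `integral_scaledIntegrand`. -/

/-! ### Lower bounds for sinh and shifts of horizontal contours -/

theorem norm_sinh_sq (x v : ℝ) :
    ‖Complex.sinh (x + v * Complex.I)‖ ^ 2 = Real.sinh x ^ 2 + Real.sin v ^ 2 := by
  have h : Complex.sinh (x + v * Complex.I)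
      = (Real.sinh x * Real.cos v : ℝ) + (Real.cosh x * Real.sin v : ℝ) * Complex.I := by
    rw [Complex.sinh_add, Complex.cosh_mul_I, Complex.sinh_mul_I]
    push_cast
    ring
  rw [h, ← Complex.normSq_eq_norm_sq, Complex.normSq_add_mul_I]
  have h1 := Real.cosh_sq x
  have h2 := Real.sin_sq_add_cos_sq v
  rw [mul_pow, mul_pow, h1, ← sub_eq_zero]
  linear_combination (Real.sinh x ^ 2) * h2

theorem sin_mul_cosh_le_norm_sinh (x v : ℝ) :
    Real.sin v * Real.cosh x ≤ ‖Complex.sinh (x + v * Complex.I)‖ := by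
  refine le_of_sq_le_sq ?_ (norm_nonneg _)
  rw [norm_sinh_sq, mul_pow, Real.cosh_sq]
  nlinarith [Real.sin_sq_le_one v, sq_nonneg (Real.sinh x)]

theorem abs_sinh_le_norm_sinh (x v : ℝ) :
    |Real.sinh x| ≤ ‖Complex.sinh (x + v * Complex.I)‖ := by
  refine abs_le_of_sq_le_sq ?_ (norm_nonneg _)
  rw [norm_sinh_sq]
  nlinarith [sq_nonneg (Real.sin v)]

theorem sinh_ne_zero_of_im {y : ℂ} (h : Real.sin y.im ≠ 0) : Complex.sinh y ≠ 0 := by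
  intro h0
  have := norm_sinh_sq y.re y.im
  rw [Complex.re_add_im, h0] at this
  have h1 : 0 < Real.sin y.im ^ 2 := by positivity
  simp only [norm_zero] at this
  nlinarith [sq_nonneg (Real.sinh y.re)]

theorem exp_abs_le_four_mul_abs_sinh {x : ℝ} (hx : 1 ≤ |x|) :
    Real.exp |x| ≤ 4 * |Real.sinh x| := by
  rw [Real.abs_sinh, Real.sinh_eq]
  have h1 := Real.add_one_le_exp |x|
  have h2 : Real.exp |x| * Real.exp (-|x|) = 1 := by rw [← Real.exp_add]; simp
  nlinarith [Real.exp_pos (-|x|)]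

theorem integrable_exp_neg_mul_abs {c : ℝ} (hc : 0 < c) :
    Integrable fun x : ℝ => Real.exp (-c * |x|) := by
  rw [← integrableOn_univ, ← Iic_union_Ioi (a := (0 : ℝ))]
  refine IntegrableOn.union ?_ ?_
  · refine (integrableOn_exp_mul_Iic hc 0).congr_fun (fun x hx => ?_) measurableSet_Iic
    simp [abs_of_nonpos (mem_Iic.1 hx)]
  · refine (integrableOn_exp_mul_Ioi (neg_lt_zero.2 hc) 0).congr_fun (fun x hx => ?_)
      measurableSet_Ioi
    simp [abs_of_pos (mem_Ioi.1 hx)]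

theorem integrable_of_norm_le_exp {f : ℝ → ℂ} (hf : Continuous f) {C c : ℝ} (hc : 0 < c)
    (h : ∀ x : ℝ, 1 ≤ |x| → ‖f x‖ ≤ C * Real.exp (-c * |x|)) : Integrable f := by
  refine hf.locallyIntegrable.integrable_of_isBigO_cocompact (g := fun x => Real.exp (-c * |x|))
    ?_ ((integrable_exp_neg_mul_abs hc).integrableAtFilter _)
  refine Asymptotics.IsBigO.of_bound C ?_
  have : ∀ᶠ x : ℝ in cocompact ℝ, 1 ≤ ‖x‖ := tendsto_norm_cocompact_atTop.eventually_ge_atTop 1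
  filter_upwards [this] with x hx
  rw [Real.norm_eq_abs (Real.exp _), Real.abs_exp]
  exact h x hx

/-- Two horizontal contours bounding a strip in which the integrand is holomorphic and decays
exponentially give the same integral. -/
theorem integral_horizontal_eq {f : ℂ → ℂ} {a b C c : ℝ} (hab : a ≤ b) (hc : 0 < c)
    (hd : DifferentiableOn ℂ f {y | y.im ∈ Icc a b})
    (hbd : ∀ x v : ℝ, 1 ≤ |x| → v ∈ Icc a b →
      ‖f (x + v * Complex.I)‖ ≤ C * Real.exp (-c * |x|)) :
    ∫ x : ℝ, f (x + a * Complex.I) = ∫ x : ℝ, f (x + b * Complex.I) := by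
  have hint : ∀ v ∈ Icc a b, Integrable fun x : ℝ => f (x + v * Complex.I) := by
    intro v hv
    refine integrable_of_norm_le_exp ?_ hc (fun x hx => hbd x v hx hv)
    refine hd.continuousOn.comp_continuous (by fun_prop) fun x => ?_
    simpa using hv
  have hlim : ∀ v ∈ Icc a b, Tendsto (fun R : ℝ => ∫ x in (-R)..R, f (x + v * Complex.I)) atTop
      (𝓝 (∫ x : ℝ, f (x + v * Complex.I))) := fun v hv =>
    intervalIntegral_tendsto_integral (hint v hv) tendsto_neg_atTop_atBot tendsto_id
  have hexp : Tendsto (fun R : ℝ => C * Real.exp (-c * R) * |b - a|) atTop (𝓝 0) := by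
    have h1 : Tendsto (fun R : ℝ => -c * R) atTop atBot :=
      tendsto_id.const_mul_atTop_of_neg (neg_lt_zero.2 hc)
    simpa using ((Real.tendsto_exp_atBot.comp h1).const_mul C).mul_const |b - a|
  -- The vertical sides of the rectangle: s = 1 is the right one, s = -1 the left one. Each is at
  -- most C e^(-cR) |b - a|.
  have hside : ∀ s : ℝ, |s| = 1 →
      Tendsto (fun R : ℝ => ∫ v in a..b, f ((s * R : ℝ) + v * Complex.I)) atTop (𝓝 0) := by
    intro s hs
    refine squeeze_zero_norm' ?_ hexp
    filter_upwards [eventually_ge_atTop 1] with R hR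
    refine intervalIntegral.norm_integral_le_of_norm_le_const fun v hv => ?_
    rw [uIoc_of_le hab] at hv
    have habs : |s * R| = R := by rw [abs_mul, hs, one_mul, abs_of_nonneg (by linarith)]
    have := hbd (s * R) v (by rw [habs]; exact hR) ⟨hv.1.le, hv.2⟩
    rwa [habs] at this
  have hrect : ∀ R : ℝ, (∫ x in (-R)..R, f (x + a * Complex.I))
      - (∫ x in (-R)..R, f (x + b * Complex.I))
      + Complex.I • (∫ v in a..b, f ((1 * R : ℝ) + v * Complex.I))
      - Complex.I • (∫ v in a..b, f ((-1 * R : ℝ) + v * Complex.I)) = 0 := by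
    intro R
    have := Complex.integral_boundary_rect_eq_zero_of_differentiableOn f
      (((-R : ℝ) : ℂ) + a * Complex.I) ((R : ℂ) + b * Complex.I) (hd.mono ?_)
    · simpa using this
    · rintro y ⟨-, hy⟩
      simpa [uIcc_of_le hab] using hy
  have h := (((hlim a (left_mem_Icc.2 hab)).sub (hlim b (right_mem_Icc.2 hab))).add
    ((hside 1 (by simp)).const_smul Complex.I)).sub ((hside (-1) (by simp)).const_smul Complex.I)
  simp only [hrect, smul_zero, add_zero, sub_zero] at h
  exact sub_eq_zero.1 (tendsto_nhds_unique h tendsto_const_nhds)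

/-! ### The Fourier integral of 1/sinh -/

theorem integral_inv_cosh : ∫ x : ℝ, (Real.cosh x)⁻¹ = Real.pi := by
  have hderiv : ∀ x : ℝ, HasDerivAt (fun x => Real.arctan (Real.sinh x)) (Real.cosh x)⁻¹ x := by
    intro x
    convert (Real.hasDerivAt_sinh x).arctan using 1
    have := Real.cosh_pos x
    rw [← Real.cosh_sq']
    field_simp
  have hint : Integrable fun x : ℝ => (Real.cosh x)⁻¹ := by
    refine ((integrable_exp_neg_mul_abs one_pos).const_mul 2).mono'
      (Real.continuous_cosh.inv₀ fun x => (Real.cosh_pos x).ne').aestronglyMeasurable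
      (Eventually.of_forall fun x => ?_)
    rw [Real.norm_of_nonneg (inv_nonneg.2 (Real.cosh_pos x).le), neg_one_mul, Real.exp_neg,
      ← div_eq_mul_inv, ← Real.cosh_abs, inv_le_comm₀ (Real.cosh_pos _) (by positivity), inv_div,
      Real.cosh_eq]
    linarith [Real.exp_pos (-|x|)]
  have hs : Tendsto Real.sinh atTop atTop := Real.sinhOrderIso.tendsto_atTop
  have hs' : Tendsto Real.sinh atBot atBot := Real.sinhOrderIso.tendsto_atBot
  have h1 : Tendsto (fun x => Real.arctan (Real.sinh x)) atTop (𝓝 (Real.pi / 2)) :=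
    (tendsto_nhds_of_tendsto_nhdsWithin Real.tendsto_arctan_atTop).comp hs
  have h2 : Tendsto (fun x => Real.arctan (Real.sinh x)) atBot (𝓝 (-(Real.pi / 2))) :=
    (tendsto_nhds_of_tendsto_nhdsWithin Real.tendsto_arctan_atBot).comp hs'
  rw [integral_of_hasDerivAt_of_tendsto hderiv hint h2 h1]
  ring

/-- The integrand of the Fourier integral of `1 / sinh`. -/
def expDivSinh (w y : ℂ) : ℂ := Complex.exp (-Complex.I * y * w / Real.pi) / Complex.sinh y

theorem norm_exp_line (w : ℂ) (x v : ℝ) :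
    ‖Complex.exp (-Complex.I * (x + v * Complex.I) * w / Real.pi)‖
      = Real.exp ((v * w.re + x * w.im) / Real.pi) := by
  rw [Complex.norm_exp, Complex.div_ofReal_re]
  congr 2
  simp
  ring

/-- The numerator grows at most like e^(|x| |Im w|/π), while |sinh| is at least |sinh x| at every
height. The bound is uniform for |v| ≤ π, which allows a contour to cross the real axis. -/
theorem norm_expDivSinh_le {w : ℂ} {x v : ℝ} (hx : 1 ≤ |x|) (hv : |v| ≤ Real.pi) :
    ‖expDivSinh w (x + v * Complex.I)‖
      ≤ 4 * Real.exp |w.re| * Real.exp (-(1 - |w.im| / Real.pi) * |x|) := by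
  have h1 := exp_abs_le_four_mul_abs_sinh hx
  have h2 := abs_sinh_le_norm_sinh x v
  have hpos : 0 < ‖Complex.sinh (x + v * Complex.I)‖ := by
    linarith [Real.exp_pos |x|]
  rw [expDivSinh, norm_div, norm_exp_line, div_le_iff₀ hpos]
  have h3 : (v * w.re + x * w.im) / Real.pi
      ≤ |w.re| + (-(1 - |w.im| / Real.pi) * |x|) + |x| := by
    have : (v * w.re + x * w.im) ≤ Real.pi * |w.re| + |x| * |w.im| := by
      refine add_le_add ((le_abs_self _).trans ?_) ((le_abs_self _).trans (abs_mul _ _).le)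
      rw [abs_mul]
      exact mul_le_mul_of_nonneg_right hv (abs_nonneg _)
    rw [div_le_iff₀ Real.pi_pos]
    refine this.trans (le_of_eq ?_)
    field_simp
    ring
  calc _ ≤ Real.exp (|w.re| + (-(1 - |w.im| / Real.pi) * |x|) + |x|) := Real.exp_le_exp.2 h3
    _ = Real.exp |w.re| * Real.exp (-(1 - |w.im| / Real.pi) * |x|) * Real.exp |x| := by
        rw [Real.exp_add, Real.exp_add]
    _ ≤ Real.exp |w.re| * Real.exp (-(1 - |w.im| / Real.pi) * |x|)
          * (4 * ‖Complex.sinh (x + v * Complex.I)‖) := by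
        gcongr
        linarith
    _ = _ := by ring

theorem differentiableOn_expDivSinh (w : ℂ) :
    DifferentiableOn ℂ (expDivSinh w) {y | Complex.sinh y ≠ 0} := by
  intro y hy
  refine DifferentiableAt.differentiableWithinAt ?_
  unfold expDivSinh
  exact DifferentiableAt.div (by fun_prop) (Complex.differentiable_sinh y) hy

theorem sinh_line_ne_zero {v : ℝ} (hv0 : 0 < v) (hv : v < Real.pi) (x : ℝ) :
    Complex.sinh (x + v * Complex.I) ≠ 0 :=
  sinh_ne_zero_of_im (by simpa using (Real.sin_pos_of_pos_of_lt_pi hv0 hv).ne')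

theorem one_sub_abs_im_pos {w : ℂ} (hw : |w.im| < Real.pi) : 0 < 1 - |w.im| / Real.pi := by
  rw [sub_pos, div_lt_one Real.pi_pos]
  exact hw

theorem continuous_expDivSinh_line {v : ℝ} (hv0 : 0 < v) (hv : v < Real.pi) (w : ℂ) :
    Continuous fun x : ℝ => expDivSinh w (x + v * Complex.I) :=
  (differentiableOn_expDivSinh w).continuousOn.comp_continuous (by fun_prop)
    fun x => sinh_line_ne_zero hv0 hv x

theorem integrable_expDivSinh_line {v : ℝ} (hv0 : 0 < v) (hv : v < Real.pi) {w : ℂ}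
    (hw : |w.im| < Real.pi) : Integrable fun x : ℝ => expDivSinh w (x + v * Complex.I) :=
  integrable_of_norm_le_exp (continuous_expDivSinh_line hv0 hv w) (one_sub_abs_im_pos hw)
    fun _ hx => norm_expDivSinh_le hx (by rw [abs_of_pos hv0]; exact hv.le)

/-- `expDivSinh w - expDivSinh 0`, extended holomorphically over the origin. -/
def expSubOneDivSinh (w y : ℂ) : ℂ :=
  dslope (fun y => Complex.exp (-Complex.I * y * w / Real.pi)) 0 y / dslope Complex.sinh 0 y

theorem expSubOneDivSinh_of_ne (w : ℂ) {y : ℂ} (hy : y ≠ 0) :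
    expSubOneDivSinh w y = expDivSinh w y - expDivSinh 0 y := by
  rw [expSubOneDivSinh, dslope_of_ne _ hy, dslope_of_ne _ hy, slope_def_field, slope_def_field]
  simp only [expDivSinh, Complex.sinh_zero, mul_zero, zero_mul, zero_div, Complex.exp_zero,
    sub_zero, ← sub_div]
  rw [div_div_div_cancel_right₀ hy]

/-- The only zero of sinh in this strip is the origin, and it is simple. -/
theorem dslope_sinh_ne_zero {y : ℂ} (hy : |y.im| < Real.pi) : dslope Complex.sinh 0 y ≠ 0 := by
  by_cases h : y = 0
  · rw [h, dslope_same, (Complex.hasDerivAt_sinh 0).deriv]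
    simp
  rw [dslope_of_ne _ h, slope_def_field, Complex.sinh_zero, sub_zero, sub_zero]
  refine div_ne_zero ?_ h
  by_cases hi : y.im = 0
  · intro h0
    have hn := abs_sinh_le_norm_sinh y.re y.im
    rw [Complex.re_add_im, h0, norm_zero] at hn
    have : Real.sinh y.re = 0 := abs_eq_zero.1 (le_antisymm hn (abs_nonneg _))
    exact h (Complex.ext (by simpa using this) (by simpa using hi))
  · refine sinh_ne_zero_of_im ?_
    rw [abs_lt] at hy
    intro h0
    exact hi ((Real.sin_eq_zero_iff_of_lt_of_lt hy.1 hy.2).1 h0)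

theorem differentiableOn_expSubOneDivSinh (w : ℂ) :
    DifferentiableOn ℂ (expSubOneDivSinh w) {y | |y.im| < Real.pi} := by
  have h1 : Differentiable ℂ
      (dslope (fun y => Complex.exp (-Complex.I * y * w / Real.pi)) 0) := by
    rw [← differentiableOn_univ, Complex.differentiableOn_dslope univ_mem]
    fun_prop
  have h2 : Differentiable ℂ (dslope Complex.sinh 0) := by
    rw [← differentiableOn_univ, Complex.differentiableOn_dslope univ_mem]
    exact Complex.differentiable_sinh.differentiableOn
  exact h1.differentiableOn.div h2.differentiableOn fun y hy => dslope_sinh_ne_zero hy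

/-- No pole lies strictly between the heights 0 and π, so the line can be moved to height π/2, where
sinh(x + iπ/2) = i cosh x. -/
theorem integral_expDivSinh_zero {v : ℝ} (hv0 : 0 < v) (hv : v < Real.pi) :
    ∫ x : ℝ, expDivSinh 0 (x + v * Complex.I) = -Real.pi * Complex.I := by
  have key : ∀ a b : ℝ, 0 < a → a ≤ b → b < Real.pi →
      ∫ x : ℝ, expDivSinh 0 (x + a * Complex.I) = ∫ x : ℝ, expDivSinh 0 (x + b * Complex.I) := by
    intro a b ha hab hb
    refine integral_horizontal_eq hab (one_sub_abs_im_pos (w := 0) (by simpa using Real.pi_pos))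
      ((differentiableOn_expDivSinh 0).mono fun y hy => ?_)
      (fun x v hx hv => norm_expDivSinh_le hx ?_)
    · have := sinh_line_ne_zero (ha.trans_le hy.1) (hy.2.trans_lt hb) y.re
      rwa [Complex.re_add_im] at this
    · rw [abs_of_pos (ha.trans_le hv.1)]
      exact hv.2.trans hb.le
  have hpi := Real.pi_pos
  have h1 : ∫ x : ℝ, expDivSinh 0 (x + v * Complex.I)
      = ∫ x : ℝ, expDivSinh 0 (x + (Real.pi / 2 : ℝ) * Complex.I) := by
    rcases le_total v (Real.pi / 2) with h | h
    · exact key _ _ hv0 h (by linarith)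
    · exact (key _ _ (by linarith) h hv).symm
  have h2 : ∀ x : ℝ, expDivSinh 0 (x + (Real.pi / 2 : ℝ) * Complex.I)
      = -Complex.I * ((Real.cosh x)⁻¹ : ℝ) := by
    intro x
    rw [expDivSinh, Complex.sinh_add, Complex.cosh_mul_I, Complex.sinh_mul_I,
      ← Complex.ofReal_cos, ← Complex.ofReal_sin, Real.cos_pi_div_two, Real.sin_pi_div_two]
    have : Complex.cosh x ≠ 0 := by
      rw [← Complex.ofReal_cosh]
      exact_mod_cast (Real.cosh_pos x).ne'
    push_cast
    simp
  rw [h1]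
  simp only [h2]
  rw [integral_const_mul, integral_complex_ofReal, integral_inv_cosh]
  ring

theorem one_add_exp_neg_ne_zero {w : ℂ} (hw : |w.im| < Real.pi) : 1 + Complex.exp (-w) ≠ 0 := by
  intro h
  have h1 : Complex.exp (-w) = -1 := by linear_combination h
  rw [← Complex.exp_pi_mul_I, Complex.exp_eq_exp_iff_exists_int] at h1
  obtain ⟨n, hn⟩ := h1
  have h2 := congrArg Complex.im hn
  simp at h2
  rw [abs_lt] at hw
  have hpi := Real.pi_pos
  have h3 : (-1 : ℝ) < n := by nlinarith
  have h4 : (n : ℝ) < 0 := by nlinarith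
  have h5 : -1 < n := by exact_mod_cast h3
  have h6 : n < 0 := by exact_mod_cast h4
  omega

theorem expDivSinh_sub_pi (w : ℂ) (y : ℂ) :
    expDivSinh w (y - Real.pi * Complex.I) = -Complex.exp (-w) * expDivSinh w y := by
  have hpi : (Real.pi : ℂ) ≠ 0 := by exact_mod_cast Real.pi_ne_zero
  have h1 : Complex.sinh (y - Real.pi * Complex.I) = -Complex.sinh y := by
    rw [Complex.sinh_sub, Complex.cosh_mul_I, Complex.sinh_mul_I]
    simp
  have h2 : -Complex.I * (y - Real.pi * Complex.I) * w / Real.pi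
      = -w + -Complex.I * y * w / Real.pi := by
    field_simp
    linear_combination (Real.pi * w : ℂ) * Complex.I_sq
  rw [expDivSinh, expDivSinh, h1, h2, Complex.exp_add, div_neg]
  ring

/-- The Fourier integral of `1 / sinh` along a line `ℝ + iv` with `0 < v < π`. -/
theorem integral_expDivSinh {v : ℝ} (hv0 : 0 < v) (hv : v < Real.pi) {w : ℂ}
    (hw : |w.im| < Real.pi) :
    ∫ x : ℝ, expDivSinh w (x + v * Complex.I)
      = -2 * Real.pi * Complex.I * (1 / (1 + Complex.exp (-w))) := by
  have hw0 : |(0 : ℂ).im| < Real.pi := by simpa using Real.pi_pos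
  have hshift : ∀ w x, expDivSinh w ((x : ℂ) + ((v - Real.pi : ℝ) : ℂ) * Complex.I)
      = -Complex.exp (-w) * expDivSinh w (x + v * Complex.I) := by
    intro w x
    rw [← expDivSinh_sub_pi]
    congr 1
    push_cast
    ring
  have hne : ∀ u : ℝ, u ≠ 0 → ∀ x : ℝ, (x : ℂ) + u * Complex.I ≠ 0 := by
    intro u hu x h
    have := congrArg Complex.im h
    simp at this
    exact hu this
  -- Subtracting the integrand for w = 0 removes the pole at the origin, so the contour may pass
  -- from height v - π < 0 to v > 0 without a residue.
  have key : ∫ x : ℝ, expSubOneDivSinh w (x + ((v - Real.pi : ℝ) : ℂ) * Complex.I)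
      = ∫ x : ℝ, expSubOneDivSinh w (x + v * Complex.I) := by
    have hpi := Real.pi_pos
    refine integral_horizontal_eq (by linarith) (one_sub_abs_im_pos hw)
      (C := 4 * Real.exp |w.re| + 4)
      ((differentiableOn_expSubOneDivSinh w).mono fun y hy => ?_)
      (fun x u hx hu => ?_)
    · have hy1 : v - Real.pi ≤ y.im := hy.1
      have hy2 : y.im ≤ v := hy.2
      change |y.im| < Real.pi
      exact abs_lt.2 ⟨by linarith, by linarith⟩
    · have hx0 : (x : ℂ) + u * Complex.I ≠ 0 := by
        intro h
        have := congrArg Complex.re h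
        simp at this
        rw [this] at hx
        norm_num at hx
      have hu' : |u| ≤ Real.pi := abs_le.2 ⟨by linarith [hu.1], by linarith [hu.2]⟩
      rw [expSubOneDivSinh_of_ne w hx0]
      refine (norm_sub_le _ _).trans ?_
      rw [add_mul]
      refine add_le_add (norm_expDivSinh_le hx hu') ?_
      refine (norm_expDivSinh_le hx hu').trans ?_
      simp only [Complex.zero_re, Complex.zero_im, abs_zero, Real.exp_zero, mul_one, zero_div,
        sub_zero]
      gcongr
      have : 0 ≤ |w.im| / Real.pi := by positivity
      linarith
  have hJ := integrable_expDivSinh_line hv0 hv hw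
  have hJ0 := integrable_expDivSinh_line hv0 hv hw0
  -- With J(w) the integral at height v, the shift by πi multiplies the integrand by -e^(-w). So
  -- `key` reads -e^(-w) J(w) + J(0) = J(w) - J(0), that is (1 + e^(-w)) J(w) = 2 J(0) = -2πi.
  simp only [expSubOneDivSinh_of_ne w (hne _ (sub_neg.2 hv).ne _),
    expSubOneDivSinh_of_ne w (hne _ hv0.ne' _), hshift] at key
  rw [integral_sub (hJ.const_mul _) (hJ0.const_mul _), integral_sub hJ hJ0, integral_const_mul,
    integral_const_mul, integral_expDivSinh_zero hv0 hv] at key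
  have hden := one_add_exp_neg_ne_zero hw
  rw [neg_zero, Complex.exp_zero] at key
  rw [mul_one_div, eq_div_iff hden]
  linear_combination -key

/-! ### Bounds for the logistic function -/

/-- The logistic function `1 / (1 + e^(-w))`, which is `-∂² Li₂(-e^w)`. -/
def logistic (w : ℂ) : ℂ := 1 / (1 + Complex.exp (-w))

theorem sin_le_norm_one_add_exp {w : ℂ} {θ : ℝ} (hw : |w.im| ≤ θ)
    (hθ : θ < Real.pi) : Real.sin θ ≤ ‖1 + Complex.exp w‖ := by
  refine le_of_sq_le_sq ?_ (norm_nonneg _)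
  have hcos : Real.cos θ ≤ Real.cos w.im := by
    rw [← Real.cos_abs w.im]
    exact Real.cos_le_cos_of_nonneg_of_le_pi (abs_nonneg _) hθ.le hw
  rw [← Complex.normSq_eq_norm_sq, Complex.normSq_apply]
  simp only [Complex.add_re, Complex.add_im, Complex.one_re, Complex.one_im, Complex.exp_re,
    Complex.exp_im]
  have h1 := Real.sin_sq_add_cos_sq w.im
  have h2 := Real.sin_sq_add_cos_sq θ
  have h3 := Real.exp_pos w.re
  have h4 := mul_le_mul_of_nonneg_left hcos h3.le
  have h5 : (1 + Real.exp w.re * Real.cos w.im) * (1 + Real.exp w.re * Real.cos w.im)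
      + (0 + Real.exp w.re * Real.sin w.im) * (0 + Real.exp w.re * Real.sin w.im)
      = 1 + 2 * (Real.exp w.re * Real.cos w.im) + Real.exp w.re ^ 2 := by
    linear_combination (Real.exp w.re ^ 2) * h1
  rw [h5]
  -- With r = e^(Re w): 1 + 2r cos θ + r² = (r + cos θ)² + sin² θ.
  nlinarith [sq_nonneg (Real.exp w.re + Real.cos θ)]

theorem norm_logistic_le {w : ℂ} {θ : ℝ} (hw : |w.im| ≤ θ) (h0 : 0 < θ) (hθ : θ < Real.pi) :
    ‖logistic w‖ ≤ (Real.sin θ)⁻¹ := by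
  rw [logistic, norm_div, norm_one, one_div]
  exact inv_anti₀ (Real.sin_pos_of_pos_of_lt_pi h0 hθ)
    (sin_le_norm_one_add_exp (by simpa using hw) hθ)

theorem logistic_eq {w : ℂ} : logistic w = Complex.exp w / (1 + Complex.exp w) := by
  have h := Complex.exp_ne_zero w
  rw [logistic, Complex.exp_neg, ← mul_div_mul_left _ _ h, mul_one, mul_add,
    mul_inv_cancel₀ h, mul_one, add_comm]

theorem norm_logistic_le_exp {w : ℂ} {θ : ℝ} (hw : |w.im| ≤ θ) (h0 : 0 < θ)
    (hθ : θ < Real.pi) : ‖logistic w‖ ≤ Real.exp w.re * (Real.sin θ)⁻¹ := by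
  rw [logistic_eq, norm_div, Complex.norm_exp, div_eq_mul_inv]
  exact mul_le_mul_of_nonneg_left (inv_anti₀ (Real.sin_pos_of_pos_of_lt_pi h0 hθ)
    (sin_le_norm_one_add_exp hw hθ)) (Real.exp_pos _).le

theorem differentiableAt_logistic {w : ℂ} (hw : |w.im| < Real.pi) :
    DifferentiableAt ℂ logistic w := by
  unfold logistic
  exact DifferentiableAt.div (by fun_prop) (by fun_prop) (one_add_exp_neg_ne_zero hw)

/-- Every `w` in the strip has room up to some `θ < π`. -/
theorem exists_strip {w : ℂ} (hw : |w.im| < Real.pi) : ∃ θ, |w.im| < θ ∧ 0 < θ ∧ θ < Real.pi :=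
  let ⟨θ, h1, h2⟩ := exists_between hw
  ⟨θ, h1, (abs_nonneg _).trans_lt h1, h2⟩

/-! ### The dilogarithm as an integral of the logistic function -/

theorem one_sub_mul_mem_slitPlane {w : ℂ} (hw : 1 - w ∈ Complex.slitPlane) {t : ℝ}
    (ht : t ∈ Icc (0 : ℝ) 1) : 1 - (t : ℂ) * w ∈ Complex.slitPlane := by
  rw [Complex.mem_slitPlane_iff] at hw ⊢
  simp only [Complex.sub_re, Complex.sub_im, Complex.one_re, Complex.one_im,
    Complex.re_ofReal_mul, Complex.im_ofReal_mul, zero_sub, neg_ne_zero] at hw ⊢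
  rcases ht.1.eq_or_lt with h0 | h0
  · left
    rw [← h0]
    norm_num
  rcases hw with h | h
  · left
    nlinarith [ht.2, mul_pos h0 h]
  · right
    positivity

/-- The singularity at t = 0 is removable: the integrand is the divided difference at 0 of t ↦ log(1
- tw), which extends continuously to [0, 1]. -/
theorem intervalIntegrable_log_div {w : ℂ} (hw : 1 - w ∈ Complex.slitPlane) :
    IntervalIntegrable (fun t : ℝ => Complex.log (1 - (t : ℂ) * w) / (t : ℂ)) volume 0 1 := by
  set U : Set ℂ := {t : ℂ | 1 - t * w ∈ Complex.slitPlane}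
  have hU : IsOpen U := Complex.isOpen_slitPlane.preimage (by fun_prop)
  have h0 : (0 : ℂ) ∈ U := by simp [U]
  have hd : DifferentiableOn ℂ (fun t : ℂ => Complex.log (1 - t * w)) U := fun t ht =>
    (DifferentiableAt.clog (f := fun t : ℂ => 1 - t * w) (by fun_prop) ht).differentiableWithinAt
  have hc : ContinuousOn (dslope (fun t : ℂ => Complex.log (1 - t * w)) 0) U :=
    (continuousOn_dslope (hU.mem_nhds h0)).2
      ⟨hd.continuousOn, hd.differentiableAt (hU.mem_nhds h0)⟩
  have hc' : ContinuousOn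
      (fun t : ℝ => dslope (fun t : ℂ => Complex.log (1 - t * w)) 0 (t : ℂ)) (uIcc 0 1) := by
    refine hc.comp (by fun_prop) fun t ht => ?_
    rw [uIcc_of_le zero_le_one] at ht
    exact one_sub_mul_mem_slitPlane hw ht
  refine hc'.intervalIntegrable.congr fun t ht => ?_
  rw [uIoc_of_le zero_le_one] at ht
  have ht0 : (t : ℂ) ≠ 0 := by exact_mod_cast ht.1.ne'
  simp only [dslope_of_ne _ ht0, slope_def_field]
  simp

/-- Differentiation under the integral. The derivative stays an integral, rather than -log(1 - w)/w,
so that w = 0 is covered; continuity of `Li2` at 0 is needed later. -/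
theorem hasDerivAt_Li2 {w : ℂ} (hw : 1 - w ∈ Complex.slitPlane) :
    HasDerivAt Li2 (∫ t in (0 : ℝ)..1, 1 / (1 - (t : ℂ) * w)) w := by
  have hU : IsOpen {w : ℂ | 1 - w ∈ Complex.slitPlane} :=
    Complex.isOpen_slitPlane.preimage (by fun_prop)
  obtain ⟨r, hr, hball⟩ := Metric.nhds_basis_closedBall.mem_iff.1 (hU.mem_nhds hw)
  have hne : ∀ t ∈ Icc (0 : ℝ) 1, ∀ v ∈ Metric.closedBall w r, 1 - (t : ℂ) * v ≠ 0 :=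
    fun t ht v hv => Complex.slitPlane_ne_zero (one_sub_mul_mem_slitPlane (hball hv) ht)
  have hcont : ContinuousOn (fun p : ℝ × ℂ => 1 / (1 - (p.1 : ℂ) * p.2))
      (Icc (0 : ℝ) 1 ×ˢ Metric.closedBall w r) :=
    ContinuousOn.div (by fun_prop) (by fun_prop) fun p hp => hne p.1 hp.1 p.2 hp.2
  obtain ⟨C, hC⟩ := (isCompact_Icc.prod (isCompact_closedBall w r)).exists_bound_of_continuousOn
    hcont
  have key := intervalIntegral.hasDerivAt_integral_of_dominated_loc_of_deriv_le
    (μ := volume) (a := 0) (b := 1) (bound := fun _ => C)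
    (F := fun v (t : ℝ) => Complex.log (1 - (t : ℂ) * v) / (t : ℂ))
    (F' := fun v (t : ℝ) => -(1 / (1 - (t : ℂ) * v))) (x₀ := w)
    (Metric.closedBall_mem_nhds w hr)
    (Eventually.of_forall fun v => (by
      refine Measurable.aestronglyMeasurable ?_
      fun_prop)) (intervalIntegrable_log_div hw)
    (Measurable.aestronglyMeasurable (by fun_prop))
    (Eventually.of_forall fun t ht v hv => ?_)
    intervalIntegrable_const
    (Eventually.of_forall fun t ht v hv => ?_)
  · have h := key.2.neg
    rw [intervalIntegral.integral_neg, neg_neg] at h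
    exact h
  · rw [uIoc_of_le zero_le_one] at ht
    rw [norm_neg]
    exact hC (t, v) ⟨⟨ht.1.le, ht.2⟩, hv⟩
  · rw [uIoc_of_le zero_le_one] at ht
    have ht0 : (t : ℂ) ≠ 0 := by exact_mod_cast ht.1.ne'
    have hs := one_sub_mul_mem_slitPlane (hball hv) ⟨ht.1.le, ht.2⟩
    have hd : HasDerivAt (fun v : ℂ => 1 - (t : ℂ) * v) (-(t : ℂ)) v := by
      simpa using ((hasDerivAt_id v).const_mul (t : ℂ)).const_sub 1
    refine ((hd.clog hs).div_const (t : ℂ)).congr_deriv ?_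
    rw [neg_div, neg_div, div_right_comm, div_self ht0]

theorem integral_one_div_one_sub_mul {w : ℂ} (hw : 1 - w ∈ Complex.slitPlane) :
    (∫ t in (0 : ℝ)..1, 1 / (1 - (t : ℂ) * w)) * w = -Complex.log (1 - w) := by
  have hs : ∀ t ∈ uIcc (0 : ℝ) 1, 1 - (t : ℂ) * w ∈ Complex.slitPlane := by
    intro t ht
    rw [uIcc_of_le zero_le_one] at ht
    exact one_sub_mul_mem_slitPlane hw ht
  rw [← intervalIntegral.integral_mul_const]
  rw [intervalIntegral.integral_eq_sub_of_hasDerivAt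
    (f := fun t : ℝ => -Complex.log (1 - (t : ℂ) * w))]
  · simp
  · intro t ht
    have hd : HasDerivAt (fun t : ℝ => 1 - (t : ℂ) * w) (-w) t := by
      simpa using ((Complex.ofRealCLM.hasDerivAt (x := t)).mul_const w).const_sub 1
    refine (hd.clog_real (hs t ht)).neg.congr_deriv ?_
    ring
  · refine ContinuousOn.intervalIntegrable ?_
    refine ContinuousOn.mul (ContinuousOn.div (by fun_prop) (by fun_prop) fun t ht => ?_)
      continuousOn_const
    exact Complex.slitPlane_ne_zero (hs t ht)

theorem one_add_exp_mem_slitPlane {z : ℂ} (hz : |z.im| < Real.pi) :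
    1 + Complex.exp z ∈ Complex.slitPlane := by
  rw [Complex.mem_slitPlane_iff]
  simp only [Complex.add_re, Complex.add_im, Complex.one_re, Complex.one_im, Complex.exp_re,
    Complex.exp_im, zero_add]
  by_cases h : z.im = 0
  · left
    rw [h, Real.cos_zero]
    positivity
  · right
    refine mul_ne_zero (Real.exp_pos _).ne' fun h0 => h ?_
    rw [abs_lt] at hz
    exact (Real.sin_eq_zero_iff_of_lt_of_lt hz.1 hz.2).1 h0

theorem hasDerivAt_Li2_neg_exp {z : ℂ} (hz : |z.im| < Real.pi) :
    HasDerivAt (fun z => Li2 (-Complex.exp z)) (-Complex.log (1 + Complex.exp z)) z := by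
  have hs : 1 - -Complex.exp z ∈ Complex.slitPlane := by
    rw [sub_neg_eq_add]
    exact one_add_exp_mem_slitPlane hz
  have h := (hasDerivAt_Li2 hs).comp z (Complex.hasDerivAt_exp z).neg
  rw [integral_one_div_one_sub_mul hs, sub_neg_eq_add] at h
  exact h

theorem hasDerivAt_log_one_add_exp {z : ℂ} (hz : |z.im| < Real.pi) :
    HasDerivAt (fun z => Complex.log (1 + Complex.exp z)) (logistic z) z := by
  have h := ((Complex.hasDerivAt_exp z).const_add 1).clog (one_add_exp_mem_slitPlane hz)
  rw [logistic_eq]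
  exact h

theorem Li2_zero : Li2 0 = 0 := by simp [Li2]

theorem tendsto_exp_sub_atTop (z : ℂ) :
    Tendsto (fun s : ℝ => Complex.exp (z - s)) atTop (𝓝 0) := by
  rw [tendsto_zero_iff_norm_tendsto_zero]
  simp only [Complex.norm_exp, Complex.sub_re, Complex.ofReal_re, Real.exp_sub]
  exact Real.tendsto_exp_atTop.const_div_atTop _

theorem integrableOn_mul_exp_neg {a : ℝ} (ha : 0 < a) :
    IntegrableOn (fun s : ℝ => s * Real.exp (-a * s)) (Ioi 0) := by
  have h := integrableOn_rpow_mul_exp_neg_mul_rpow (p := 1) (s := 1) (b := a) (by norm_num)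
    one_pos ha
  simpa using h

/-- Integration by parts: s log(1 + e^(z-s)) - Li₂(-e^(z-s)) is a primitive of -s σ(z - s), with σ
the logistic function. It equals -Li₂(-e^z) at s = 0 and tends to 0 at infinity. -/
theorem Li2_neg_exp_eq_integral {z : ℂ} (hz : |z.im| < Real.pi) :
    Li2 (-Complex.exp z) = -∫ s : ℝ in Ioi 0, (s : ℂ) * logistic (z - s) := by
  obtain ⟨θ, hθ1, hθ0, hθ⟩ := exists_strip hz
  have him : ∀ s : ℝ, |(z - s).im| < Real.pi := by simpa using hz
  have hsub : ∀ s : ℝ, HasDerivAt (fun s : ℝ => z - (s : ℂ)) (-1) s := fun s => by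
    simpa using (Complex.ofRealCLM.hasDerivAt (x := s)).const_sub z
  have hderiv : ∀ s ∈ Ici (0 : ℝ), HasDerivAt
      (fun s : ℝ => (s : ℂ) * Complex.log (1 + Complex.exp (z - s)) - Li2 (-Complex.exp (z - s)))
      (-((s : ℂ) * logistic (z - s))) s := by
    intro s _
    have h1 := (hasDerivAt_log_one_add_exp (him s)).comp s (hsub s)
    have h2 := (hasDerivAt_Li2_neg_exp (him s)).comp s (hsub s)
    have h3 := ((Complex.ofRealCLM.hasDerivAt (x := s)).mul h1).sub h2
    refine h3.congr_deriv ?_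
    simp
  have hint : IntegrableOn (fun s : ℝ => -((s : ℂ) * logistic (z - s))) (Ioi 0) := by
    refine Integrable.neg ?_
    refine ((integrableOn_mul_exp_neg one_pos).const_mul
      (Real.exp z.re * (Real.sin θ)⁻¹)).mono' ?_ ?_
    · refine Continuous.aestronglyMeasurable ?_
      refine Complex.continuous_ofReal.mul ?_
      refine continuous_iff_continuousAt.2 fun s => ?_
      exact ContinuousAt.comp (f := fun s : ℝ => z - (s : ℂ)) (g := logistic)
        (differentiableAt_logistic (him s)).continuousAt (by fun_prop)
    · refine (ae_restrict_iff' measurableSet_Ioi).2 (Eventually.of_forall fun s hs => ?_)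
      have hs0 : (0 : ℝ) < s := hs
      have h := norm_logistic_le_exp (w := z - s) (by simpa using hθ1.le) hθ0 hθ
      rw [Complex.sub_re, Complex.ofReal_re, sub_eq_add_neg z.re, Real.exp_add] at h
      rw [norm_mul, Complex.norm_real, Real.norm_of_nonneg hs0.le, neg_one_mul]
      calc s * ‖logistic (z - s)‖
          ≤ s * (Real.exp z.re * Real.exp (-s) * (Real.sin θ)⁻¹) := by gcongr
        _ = _ := by ring
  have hlim : Tendsto
      (fun s : ℝ => (s : ℂ) * Complex.log (1 + Complex.exp (z - s)) - Li2 (-Complex.exp (z - s)))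
      atTop (𝓝 (0 - 0)) := by
    have hexp := tendsto_exp_sub_atTop z
    refine Tendsto.sub ?_ ?_
    · have hsmall : ∀ᶠ s : ℝ in atTop, ‖Complex.exp (z - s)‖ ≤ 1 / 2 := by
        have := (tendsto_zero_iff_norm_tendsto_zero.1 hexp).eventually_lt_const
          (show (0 : ℝ) < 1 / 2 by norm_num)
        exact this.mono fun s hs => hs.le
      have hb : Tendsto (fun s : ℝ => 3 / 2 * Real.exp z.re * (s ^ 1 * Real.exp (-s))) atTop
          (𝓝 0) := by
        simpa using (Real.tendsto_pow_mul_exp_neg_atTop_nhds_zero 1).const_mul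
          (3 / 2 * Real.exp z.re)
      refine squeeze_zero_norm' ?_ hb
      filter_upwards [hsmall, eventually_ge_atTop 0] with s hs hs0
      rw [norm_mul, Complex.norm_real, Real.norm_of_nonneg hs0]
      have h := Complex.norm_log_one_add_half_le_self hs
      rw [Complex.norm_exp, Complex.sub_re, Complex.ofReal_re, sub_eq_add_neg z.re, Real.exp_add] at h
      calc s * ‖Complex.log (1 + Complex.exp (z - s))‖
          ≤ s * (3 / 2 * (Real.exp z.re * Real.exp (-s))) := by gcongr
        _ = _ := by ring
    · have hc : ContinuousAt Li2 0 := (hasDerivAt_Li2 (w := 0) (by simp)).continuousAt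
      have : Tendsto (fun s : ℝ => -Complex.exp (z - s)) atTop (𝓝 0) := by simpa using hexp.neg
      have h := hc.tendsto.comp this
      rwa [Li2_zero] at h
  have h := integral_Ioi_of_hasDerivAt_of_tendsto' hderiv hint hlim
  rw [integral_neg] at h
  rw [h]
  simp

/-! ### Partial fractions of the cosecant and of 1/sinh -/

theorem hasSum_of_eq {f g : ℕ → ℂ} {a b : ℂ} (h : HasSum g b) (hf : ∀ n, f n = g n)
    (ha : a = b) : HasSum f a := by
  rwa [funext hf, ha]

theorem half_mem_integerComplement {u : ℂ} (hu : u ∈ Complex.integerComplement) :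
    u / 2 ∈ Complex.integerComplement := by
  rintro ⟨n, hn⟩
  refine hu ⟨2 * n, ?_⟩
  push_cast
  rw [hn]
  ring

/-- Index n of `cotTerm` carries the poles ±(n + 1), so the odd indices are those with even poles.
-/
theorem cotTerm_half {u : ℂ} (hu : u ∈ Complex.integerComplement) (n : ℕ) :
    cotTerm (u / 2) n = 2 * cotTerm u (2 * n + 1) := by
  have h1 : u + (2 * n + 2) ≠ 0 := by
    have := Complex.integerComplement_add_ne_zero hu (2 * n + 2)
    exact_mod_cast this
  have h2 : u - (2 * n + 2) ≠ 0 := by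
    have := Complex.integerComplement_add_ne_zero hu (-(2 * n + 2))
    push_cast at this
    rwa [← sub_eq_add_neg] at this
  have h3 : u / 2 - (n + 1) = (u - (2 * n + 2)) / 2 := by ring
  have h4 : u / 2 + (n + 1) = (u + (2 * n + 2)) / 2 := by ring
  have h5 : u - (2 * n + 1 + 1) = u - (2 * n + 2) := by ring
  have h6 : u + (2 * n + 1 + 1) = u + (2 * n + 2) := by ring
  simp only [cotTerm]
  push_cast
  rw [h3, h4, h5, h6]
  field_simp

/-- The partial fraction expansion of the cosecant. -/
theorem hasSum_cosecant {u : ℂ} (hu : u ∈ Complex.integerComplement) :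
    HasSum (fun n : ℕ => (-1) ^ (n + 1) * cotTerm u n)
      (Real.pi / Complex.sin (Real.pi * u) - 1 / u) := by
  have hu2 := half_mem_integerComplement hu
  have hfull : HasSum (cotTerm u) (Real.pi * Complex.cot (Real.pi * u) - 1 / u) := by
    rw [cot_series_rep' hu]
    exact (summable_cotTerm hu).hasSum
  have hhalf : HasSum (fun n => cotTerm u (2 * n + 1))
      ((Real.pi * Complex.cot (Real.pi * (u / 2)) - 1 / (u / 2)) / 2) := by
    have h : HasSum (cotTerm (u / 2))
        (Real.pi * Complex.cot (Real.pi * (u / 2)) - 1 / (u / 2)) := by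
      rw [cot_series_rep' hu2]
      exact (summable_cotTerm hu2).hasSum
    refine hasSum_of_eq (h.div_const 2) (fun n => ?_) rfl
    rw [cotTerm_half hu]
    ring
  have hinj : Function.Injective fun n : ℕ => 2 * n + 1 := fun a b h => by
    simp only at h
    omega
  have hodd : HasSum (fun n => if Odd n then cotTerm u n else 0)
      ((Real.pi * Complex.cot (Real.pi * (u / 2)) - 1 / (u / 2)) / 2) := by
    rw [← hinj.hasSum_iff]
    · refine hasSum_of_eq hhalf (fun n => ?_) rfl
      simp
    · rintro n hn
      rw [if_neg]
      rintro ⟨m, rfl⟩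
      exact hn ⟨m, rfl⟩
  -- This is csc(πu) = cot(πu/2) - cot(πu): twice the odd-index terms minus all terms leaves the
  -- sign (-1)^(n+1).
  refine hasSum_of_eq ((hodd.mul_left 2).sub hfull) (fun n => ?_) ?_
  · rcases n.even_or_odd with h | h
    · rw [if_neg (Nat.not_odd_iff_even.2 h), (h.add_one).neg_one_pow]
      ring
    · rw [if_pos h, (h.add_one).neg_one_pow]
      ring
  · have hs := sin_pi_mul_ne_zero hu
    have hu0 : u ≠ 0 := Complex.integerComplement.ne_zero hu
    have h2 : (Real.pi : ℂ) * u = 2 * (Real.pi * (u / 2)) := by ring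
    rw [h2, Complex.sin_two_mul] at hs
    have hs1 : Complex.sin (Real.pi * (u / 2)) ≠ 0 := fun h => hs (by rw [h]; ring)
    have hs2 : Complex.cos (Real.pi * (u / 2)) ≠ 0 := fun h => hs (by rw [h]; ring)
    rw [Complex.cot_eq_cos_div_sin, Complex.cot_eq_cos_div_sin, h2, Complex.sin_two_mul,
      Complex.cos_two_mul]
    generalize Complex.sin (Real.pi * (u / 2)) = S at hs1
    generalize Complex.cos (Real.pi * (u / 2)) = C at hs2
    field_simp
    ring

/-- The partial fraction expansion of `1 / sinh`. -/
theorem hasSum_one_div_sinh {x : ℂ} (hx : Complex.sinh x ≠ 0) :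
    HasSum (fun n : ℕ => (-1) ^ (n + 1) * (2 * x / (x ^ 2 + Real.pi ^ 2 * (n + 1) ^ 2)))
      (1 / Complex.sinh x - 1 / x) := by
  have hpi : (Real.pi : ℂ) ≠ 0 := by exact_mod_cast Real.pi_ne_zero
  have hu : -Complex.I * x / Real.pi ∈ Complex.integerComplement := by
    rintro ⟨n, hn⟩
    refine hx ?_
    have : x = (n * Real.pi : ℂ) * Complex.I := by
      rw [hn]
      field_simp
      linear_combination (x : ℂ) * Complex.I_sq
    rw [this, Complex.sinh_mul_I, Complex.sin_int_mul_pi, zero_mul]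
  have hx0 : x ≠ 0 := by
    rintro rfl
    exact hx Complex.sinh_zero
  -- The cosecant series at u = -ix/π, where sin(πu) = -i sinh x.
  refine hasSum_of_eq ((hasSum_cosecant hu).div_const (Real.pi * Complex.I)) (fun n => ?_) ?_
  · have h1 := Complex.integerComplement_add_ne_zero hu (n + 1)
    have h2 := Complex.integerComplement_add_ne_zero hu (-(n + 1))
    push_cast at h1 h2
    have h3 : (-Complex.I * x / Real.pi + (n + 1)) * (-Complex.I * x / Real.pi - (n + 1))
        = -(x ^ 2 + Real.pi ^ 2 * (n + 1) ^ 2) / Real.pi ^ 2 := by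
      field_simp
      linear_combination (x ^ 2 : ℂ) * Complex.I_sq
    have h4 : x ^ 2 + Real.pi ^ 2 * (n + 1) ^ 2 ≠ 0 := by
      intro h0
      rw [h0, neg_zero, zero_div, sub_eq_add_neg] at h3
      exact mul_ne_zero h1 h2 h3
    rw [cotTerm_identity hu, h3]
    field_simp
  · have h5 : (Real.pi : ℂ) * (-Complex.I * x / Real.pi) = -(x * Complex.I) := by
      field_simp
    rw [h5, Complex.sin_neg, Complex.sin_mul_I]
    field_simp
    rw [Complex.I_sq]
    ring

/-! ### The Borel transform and its analytic continuation -/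

theorem iteratedDeriv_Li2_neg_exp {z : ℂ} (hz : |z.im| < Real.pi) (j : ℕ) :
    iteratedDeriv (j + 2) (fun w : ℂ => Li2 (-Complex.exp w)) z = -iteratedDeriv j logistic z := by
  have hU : {w : ℂ | |w.im| < Real.pi} ∈ 𝓝 z :=
    (isOpen_lt (by fun_prop) continuous_const).mem_nhds hz
  have h1 : deriv (fun w : ℂ => Li2 (-Complex.exp w))
      =ᶠ[𝓝 z] -(fun w => Complex.log (1 + Complex.exp w)) := by
    filter_upwards [hU] with w hw using (hasDerivAt_Li2_neg_exp hw).deriv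
  have h2 : deriv (fun w : ℂ => Complex.log (1 + Complex.exp w)) =ᶠ[𝓝 z] logistic := by
    filter_upwards [hU] with w hw using (hasDerivAt_log_one_add_exp hw).deriv
  rw [iteratedDeriv_succ', h1.iteratedDeriv_eq, iteratedDeriv_neg, iteratedDeriv_succ',
    h2.iteratedDeriv_eq]

theorem hasSum_alternating_zeta (m : ℕ) :
    HasSum (fun n : ℕ => (-1 : ℂ) ^ (n + 1) / ((n : ℂ) + 1) ^ (2 * m + 2))
      ((-1) ^ m * (2 * Real.pi) ^ (2 * m + 2) / 2 / ((2 * m + 2).factorial : ℂ)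
        * ((bernoulliHalf (2 * m + 2) : ℚ) : ℂ)) := by
  -- The Fourier series of the Bernoulli polynomial at x = 1/2, where cos(2πnx) = (-1)^n. Its term n
  -- = 0 vanishes because 1/0 = 0, so the index can be shifted.
  have h := hasSum_one_div_nat_pow_mul_cos (k := m + 1) (by omega) (x := 1 / 2)
    ⟨by norm_num, by norm_num⟩
  rw [← hasSum_nat_add_iff' 1] at h
  refine hasSum_of_eq (Complex.hasSum_ofReal.2 h) (fun n => ?_) ?_
  · have hcos : Real.cos (2 * Real.pi * ((n + 1 : ℕ) : ℝ) * (1 / 2)) = (-1) ^ (n + 1) := by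
      rw [← Real.cos_nat_mul_pi (n + 1)]
      congr 1
      ring
    rw [hcos]
    push_cast
    ring
  · have heval : Polynomial.eval (1 / 2 : ℝ)
        (Polynomial.map (algebraMap ℚ ℝ) (Polynomial.bernoulli (2 * (m + 1))))
        = ((bernoulliHalf (2 * m + 2) : ℚ) : ℝ) := by
      rw [bernoulliHalf, show (1 / 2 : ℝ) = algebraMap ℚ ℝ (1 / 2) by simp,
        Polynomial.eval_map_apply]
      rfl
    rw [heval]
    simp only [Finset.range_one, Finset.sum_singleton, Nat.cast_zero]
    rw [zero_pow (by omega), show 2 * (m + 1) = 2 * m + 2 by ring]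
    push_cast
    ring

/-- The Borel transform of `phiHat z`, as a function on a strip around the real axis. -/
def borelFun (z ξ : ℂ) : ℂ :=
  1 / (2 * Real.pi * Complex.I) * ∑' n : ℕ, (-1) ^ (n + 1) / ((n : ℂ) + 1) ^ 2
    * (logistic (z + ξ / (n + 1)) + logistic (z - ξ / (n + 1)))

theorem abs_im_add_div_le (z ξ : ℂ) (n : ℕ) : |(z + ξ / (n + 1)).im| ≤ |z.im| + |ξ.im| := by
  have h : (ξ / ((n : ℂ) + 1)).im = ξ.im / ((n : ℝ) + 1) := by
    have := Complex.div_ofReal_im ξ ((n : ℝ) + 1)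
    push_cast at this
    exact this
  rw [Complex.add_im, h]
  refine (abs_add_le _ _).trans (add_le_add le_rfl ?_)
  rw [abs_div, abs_of_pos (by positivity : (0 : ℝ) < (n : ℝ) + 1)]
  exact div_le_self (abs_nonneg _) (by linarith [(Nat.cast_nonneg n : (0 : ℝ) ≤ n)])

theorem abs_im_sub_div_le (z ξ : ℂ) (n : ℕ) : |(z - ξ / (n + 1)).im| ≤ |z.im| + |ξ.im| := by
  have h := abs_im_add_div_le z (-ξ) n
  rwa [Complex.neg_im, abs_neg, neg_div, ← sub_eq_add_neg] at h

theorem norm_alternating_coeff (n : ℕ) :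
    ‖(-1 : ℂ) ^ (n + 1) / ((n : ℂ) + 1) ^ 2‖ = 1 / ((n : ℝ) + 1) ^ 2 := by
  have h : ‖(n : ℂ) + 1‖ = (n : ℝ) + 1 := by
    have := Complex.norm_natCast (n + 1)
    push_cast at this
    exact this
  rw [norm_div, norm_pow, norm_neg, norm_one, one_pow, norm_pow, h]

theorem summable_one_div_add_one_sq : Summable fun n : ℕ => 1 / ((n : ℝ) + 1) ^ 2 := by
  have h := (summable_nat_add_iff 1).2 (Real.summable_one_div_nat_pow.2 one_lt_two)
  simpa using h

theorem norm_borelTerm_le {z ξ : ℂ} {θ : ℝ} (h0 : 0 < θ) (hθ : θ < Real.pi)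
    (hξ : |z.im| + |ξ.im| ≤ θ) (n : ℕ) :
    ‖(-1) ^ (n + 1) / ((n : ℂ) + 1) ^ 2
      * (logistic (z + ξ / (n + 1)) + logistic (z - ξ / (n + 1)))‖
      ≤ 1 / ((n : ℝ) + 1) ^ 2 * (2 * (Real.sin θ)⁻¹) := by
  rw [norm_mul, norm_alternating_coeff]
  have h1 := norm_logistic_le ((abs_im_add_div_le z ξ n).trans hξ) h0 hθ
  have h2 := norm_logistic_le ((abs_im_sub_div_le z ξ n).trans hξ) h0 hθ
  gcongr
  exact (norm_add_le _ _).trans (by linarith)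

theorem summable_borelTerm {z ξ : ℂ} {θ : ℝ} (h0 : 0 < θ) (hθ : θ < Real.pi)
    (hξ : |z.im| + |ξ.im| ≤ θ) :
    Summable fun n : ℕ => (-1) ^ (n + 1) / ((n : ℂ) + 1) ^ 2
      * (logistic (z + ξ / (n + 1)) + logistic (z - ξ / (n + 1))) :=
  .of_norm_bounded (summable_one_div_add_one_sq.mul_right _) (norm_borelTerm_le h0 hθ hξ)

theorem halfStrip_subset (δ : ℝ) : halfStrip δ ⊆ {ξ | |ξ.im| < δ} := by
  intro ξ hξ
  obtain ⟨_, ⟨t, -, rfl⟩, ht⟩ := Metric.mem_thickening_iff.1 hξ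
  rw [dist_eq_norm] at ht
  have := (Complex.abs_im_le_norm (ξ - t)).trans_lt ht
  simpa using this

/-- Division by n + 1 ≥ 1 does not increase |Im ξ|, so every argument of the logistic function stays
in |Im| < θ < π. The terms are then O(1/(n+1)²) uniformly, and the Weierstrass theorem applies. -/
theorem analyticOnNhd_borelFun {z : ℂ} {θ : ℝ} (h0 : 0 < θ) (hθ : θ < Real.pi) :
    AnalyticOnNhd ℂ (borelFun z) {ξ | |ξ.im| < θ - |z.im|} := by
  have hopen : IsOpen {ξ : ℂ | |ξ.im| < θ - |z.im|} := isOpen_lt (by fun_prop) continuous_const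
  refine DifferentiableOn.analyticOnNhd ?_ hopen
  refine DifferentiableOn.const_mul ?_ _
  refine Complex.differentiableOn_tsum_of_summable_norm
    (summable_one_div_add_one_sq.mul_right (2 * (Real.sin θ)⁻¹)) (fun n ξ hξ => ?_) hopen
    (fun n ξ hξ => norm_borelTerm_le h0 hθ ?_ n)
  · have hξ' : |z.im| + |ξ.im| < Real.pi := by
      have : |ξ.im| < θ - |z.im| := hξ
      linarith
    refine DifferentiableAt.differentiableWithinAt ?_
    refine DifferentiableAt.const_mul (DifferentiableAt.add ?_ ?_) _
    · exact (differentiableAt_logistic ((abs_im_add_div_le z ξ n).trans_lt hξ')).comp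
        (f := fun ξ => z + ξ / (n + 1)) ξ (by fun_prop)
    · exact (differentiableAt_logistic ((abs_im_sub_div_le z ξ n).trans_lt hξ')).comp
        (f := fun ξ => z - ξ / (n + 1)) ξ (by fun_prop)
  · have : |ξ.im| < θ - |z.im| := hξ
    linarith

theorem norm_borelFun_le {z ξ : ℂ} {θ : ℝ} (h0 : 0 < θ) (hθ : θ < Real.pi)
    (hξ : |z.im| + |ξ.im| ≤ θ) :
    ‖borelFun z ξ‖ ≤ ‖1 / (2 * Real.pi * Complex.I)‖
      * ∑' n : ℕ, 1 / ((n : ℝ) + 1) ^ 2 * (2 * (Real.sin θ)⁻¹) := by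
  rw [borelFun, norm_mul]
  exact mul_le_mul_of_nonneg_left
    (tsum_of_norm_bounded (summable_one_div_add_one_sq.mul_right _).hasSum
      (norm_borelTerm_le h0 hθ hξ)) (norm_nonneg _)

/-- The Bernoulli factor is an alternating zeta value by `hasSum_alternating_zeta`. The factor 1 +
(-1)^j encodes parity: ξ^j comes from τ^(j+1), which is absent for odd j. -/
theorem coeff_borelTransform_phiHat {z : ℂ} (hz : |z.im| < Real.pi) (j : ℕ) :
    PowerSeries.coeff j (borelTransform (phiHat z))
      = 1 / (2 * Real.pi * Complex.I) *
        ∑' n : ℕ, (-1) ^ (n + 1) / ((n : ℂ) + 1) ^ (j + 2)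
          * ((1 + (-1) ^ j) * (iteratedDeriv j logistic z / (j.factorial : ℂ))) := by
  rw [borelTransform, PowerSeries.coeff_mk, phiHat, PowerSeries.coeff_mk]
  rcases j.even_or_odd' with ⟨m, rfl | rfl⟩
  · have hpi : (Real.pi : ℂ) ≠ 0 := by exact_mod_cast Real.pi_ne_zero
    rw [if_pos (by simp), iteratedDeriv_Li2_neg_exp hz,
      tsum_mul_right, (hasSum_alternating_zeta m).tsum_eq]
    have h1 : (-1 : ℂ) ^ (2 * m) = 1 := by simp [pow_mul]
    have h2 : (2 * Real.pi * Complex.I) ^ (2 * m + 1)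
        = (2 * Real.pi : ℂ) ^ (2 * m + 1) * ((-1) ^ m * Complex.I) := by
      rw [mul_pow, pow_succ Complex.I, pow_mul Complex.I, Complex.I_sq]
    rw [h1, h2]
    have h3 : ((2 * m + 1 + 1).factorial : ℂ) ≠ 0 := by exact_mod_cast Nat.factorial_ne_zero _
    have h4 : ((2 * m).factorial : ℂ) ≠ 0 := by exact_mod_cast Nat.factorial_ne_zero _
    rw [show 2 * m + 2 = 2 * m + 1 + 1 from rfl, pow_succ (2 * Real.pi : ℂ) (2 * m + 1)]
    field_simp
    rw [Complex.I_sq]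
    ring
  · rw [if_neg (by simp [Nat.odd_add]), (odd_two_mul_add_one m).neg_one_pow]
    simp

/-- Each logistic term is expanded in its Taylor series at z, valid for |ξ| < π - |Im z| whatever n
is, and the two summations are exchanged. -/
theorem hasFPowerSeriesAt_borelFun {z : ℂ} (hz : |z.im| < Real.pi) :
    HasFPowerSeriesAt (borelFun z)
      (FormalMultilinearSeries.ofScalars ℂ
        fun n => PowerSeries.coeff n (borelTransform (phiHat z))) 0 := by
  set r := Real.pi - |z.im| with hr
  have hr0 : 0 < r := sub_pos.2 hz
  have hball : DifferentiableOn ℂ logistic (Metric.ball z r) := by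
    intro w hw
    refine (differentiableAt_logistic ?_).differentiableWithinAt
    rw [Metric.mem_ball, dist_eq_norm] at hw
    have h1 := (Complex.abs_im_le_norm (w - z)).trans_lt hw
    have h2 : |w.im| ≤ |z.im| + |(w - z).im| := by
      have := abs_add_le z.im (w - z).im
      simpa using this
    linarith
  set a : ℕ → ℂ := fun j => iteratedDeriv j logistic z / (j.factorial : ℂ) with ha
  have htaylor : ∀ η : ℂ, ‖η‖ < r → HasSum (fun j => a j * η ^ j) (logistic (z + η)) := by
    intro η hη
    have h := Complex.hasSum_taylorSeries_on_ball hball (z := z + η) (by simpa using hη)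
    refine hasSum_of_eq h (fun j => ?_) rfl
    simp only [ha, add_sub_cancel_left, smul_eq_mul]
    ring
  rw [hasFPowerSeriesAt_iff]
  filter_upwards [Metric.ball_mem_nhds (0 : ℂ) hr0] with ξ hξ
  rw [mem_ball_zero_iff] at hξ
  simp only [FormalMultilinearSeries.coeff_ofScalars, smul_eq_mul, zero_add]
  set F : ℕ → ℕ → ℂ := fun j n =>
    (-1) ^ (n + 1) / ((n : ℂ) + 1) ^ 2 * (a j * (1 + (-1) ^ j) * (ξ / (n + 1)) ^ j) with hF
  have hn : ∀ n : ℕ, ‖ξ / ((n : ℂ) + 1)‖ ≤ ‖ξ‖ := by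
    intro n
    have : ‖(n : ℂ) + 1‖ = (n : ℝ) + 1 := by
      have := Complex.norm_natCast (n + 1)
      push_cast at this
      exact this
    rw [norm_div, this]
    exact div_le_self (norm_nonneg _) (by linarith [(Nat.cast_nonneg n : (0 : ℝ) ≤ n)])
  have hinner : ∀ n, HasSum (fun j => F j n) ((-1) ^ (n + 1) / ((n : ℂ) + 1) ^ 2
      * (logistic (z + ξ / (n + 1)) + logistic (z - ξ / (n + 1)))) := by
    intro n
    have hlt := (hn n).trans_lt hξ
    have h1 := htaylor _ hlt
    have h2 := htaylor (-(ξ / ((n : ℂ) + 1))) (by rwa [norm_neg])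
    refine hasSum_of_eq ((h1.add h2).mul_left _) (fun j => ?_) (by rw [← sub_eq_add_neg])
    simp only [hF]
    rw [neg_pow (ξ / ((n : ℂ) + 1))]
    ring
  have hsummable : Summable (Function.uncurry F) := by
    have h1 : Summable fun j => ‖a j‖ * 2 * ‖ξ‖ ^ j := by
      -- Absolute convergence of the Taylor series at the real displacement ‖ξ‖ dominates all n at
      -- once, because ‖ξ/(n+1)‖ ≤ ‖ξ‖.
      have h := (htaylor ((‖ξ‖ : ℝ) : ℂ) (by simpa using hξ)).summable.norm
      refine (h.mul_right 2).congr fun j => ?_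
      simp only [norm_mul, norm_pow, Complex.norm_real, norm_norm]
      ring
    have h2 := h1.mul_of_nonneg summable_one_div_add_one_sq (fun j => by positivity)
      (fun n => by positivity)
    refine .of_norm_bounded h2 fun p => ?_
    obtain ⟨j, n⟩ := p
    simp only [Function.uncurry, hF]
    rw [norm_mul, norm_alternating_coeff, mul_comm, norm_mul, norm_mul, norm_pow]
    have h3 : ‖(1 : ℂ) + (-1) ^ j‖ ≤ 2 := by
      refine (norm_add_le _ _).trans ?_
      rw [norm_pow, norm_neg, norm_one, one_pow]
      norm_num
    gcongr
    exact hn n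
  have hsum : HasSum (fun j => ∑' n, F j n) (∑' n : ℕ, (-1) ^ (n + 1) / ((n : ℂ) + 1) ^ 2
      * (logistic (z + ξ / (n + 1)) + logistic (z - ξ / (n + 1)))) := by
    have h1 : ∑' n : ℕ, (-1) ^ (n + 1) / ((n : ℂ) + 1) ^ 2
      * (logistic (z + ξ / (n + 1)) + logistic (z - ξ / (n + 1))) = ∑' n, ∑' j, F j n :=
      tsum_congr fun n => (hinner n).tsum_eq.symm
    have h2 : ∑' p, Function.uncurry F p = ∑' j, ∑' n, F j n := hsummable.tsum_prod
    rw [h1, hsummable.tsum_comm, ← h2]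
    exact hsummable.hasSum.prod_fiberwise fun j => (hsummable.prod_factor j).hasSum
  refine hasSum_of_eq (hsum.mul_left (1 / (2 * Real.pi * Complex.I))) (fun j => ?_) rfl
  rw [coeff_borelTransform_phiHat hz, mul_left_comm, ← tsum_mul_left]
  congr 1
  refine tsum_congr fun n => ?_
  simp only [hF, ha]
  have hn0 : (n : ℂ) + 1 ≠ 0 := Nat.cast_add_one_ne_zero n
  rw [div_pow, pow_add]
  field_simp
  ring

/-! ### Laplace integrals of the logistic function as line integrals -/

theorem logistic_eq_integral {v : ℝ} (hv0 : 0 < v) (hv : v < Real.pi) {w : ℂ}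
    (hw : |w.im| < Real.pi) :
    logistic w = Complex.I / (2 * Real.pi) * ∫ x : ℝ, expDivSinh w (x + v * Complex.I) := by
  have hpi : (Real.pi : ℂ) ≠ 0 := by exact_mod_cast Real.pi_ne_zero
  rw [integral_expDivSinh hv0 hv hw, ← logistic]
  field_simp
  rw [Complex.I_sq]
  ring

theorem expDivSinh_add (z u y : ℂ) :
    expDivSinh (z + u) y = Complex.exp (-Complex.I * y * u / Real.pi) * expDivSinh z y := by
  rw [expDivSinh, expDivSinh, mul_add, add_div, Complex.exp_add]
  ring

/-- Integrating the logistic function along a horizontal half-line against a weight `m` amounts to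
multiplying the Fourier integrand by a Laplace transform of `m`. -/
theorem integral_mul_logistic {v : ℝ} (hv0 : 0 < v) (hv : v < Real.pi) {z : ℂ}
    (hz : |z.im| < Real.pi) {m : ℝ → ℂ} (hm : Continuous m) (c : ℝ)
    (hint : IntegrableOn (fun s : ℝ => ‖m s‖ * Real.exp (v * c * s / Real.pi)) (Ioi 0)) :
    (Integrable fun x : ℝ => (∫ s : ℝ in Ioi 0,
        m s * Complex.exp (-Complex.I * (x + v * Complex.I) * c / Real.pi * s))
          * expDivSinh z (x + v * Complex.I)) ∧
    ∫ s : ℝ in Ioi 0, m s * logistic (z + c * s) =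
      Complex.I / (2 * Real.pi) * ∫ x : ℝ, (∫ s : ℝ in Ioi 0,
        m s * Complex.exp (-Complex.I * (x + v * Complex.I) * c / Real.pi * s))
          * expDivSinh z (x + v * Complex.I) := by
  have hE := continuous_expDivSinh_line hv0 hv z
  have hEint := integrable_expDivSinh_line hv0 hv hz
  set K : ℝ → ℝ → ℂ := fun s x =>
    m s * Complex.exp (-Complex.I * (x + v * Complex.I) * c / Real.pi * s)
      * expDivSinh z (x + v * Complex.I) with hK
  have hKint : Integrable (Function.uncurry K) ((volume.restrict (Ioi 0)).prod volume) := by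
    -- Since cs is real, the exponential has modulus e^(vcs/π), independent of x. The modulus of the
    -- kernel is thus a function of s times a function of x, and Fubini applies.
    refine (Integrable.mul_prod hint hEint.norm).mono' ?_ (Eventually.of_forall fun p => ?_)
    · refine Continuous.aestronglyMeasurable ?_
      simp only [hK, Function.uncurry_def]
      refine Continuous.mul (Continuous.mul (hm.comp continuous_fst) (by fun_prop))
        (hE.comp continuous_snd)
    · obtain ⟨s, x⟩ := p
      simp only [hK, Function.uncurry, norm_mul]
      refine le_of_eq ?_
      congr 2
      have h : -Complex.I * (x + v * Complex.I) * c / Real.pi * s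
          = -Complex.I * (x + v * Complex.I) * ((c * s : ℝ) : ℂ) / Real.pi := by
        push_cast
        ring
      rw [h, norm_exp_line, Complex.ofReal_re, Complex.ofReal_im]
      congr 1
      ring
  have hswap := integral_integral_swap hKint
  have hx : ∀ x : ℝ, ∫ s : ℝ in Ioi 0, K s x = (∫ s : ℝ in Ioi 0,
        m s * Complex.exp (-Complex.I * (x + v * Complex.I) * c / Real.pi * s))
          * expDivSinh z (x + v * Complex.I) := fun x => integral_mul_const _ _
  have hs : ∀ s : ℝ, m s * logistic (z + c * s)
      = Complex.I / (2 * Real.pi) * ∫ x : ℝ, K s x := by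
    intro s
    have h : |(z + c * s).im| < Real.pi := by simpa using hz
    rw [logistic_eq_integral hv0 hv h, mul_left_comm, ← integral_const_mul (m s)]
    congr 1
    refine integral_congr_ae (Eventually.of_forall fun x => ?_)
    simp only [hK]
    rw [expDivSinh_add, ← mul_assoc]
    congr 3
    ring
  refine ⟨(hKint.integral_prod_right).congr (Eventually.of_forall hx), ?_⟩
  simp only [hs]
  rw [integral_const_mul, hswap]
  simp only [hx]

theorem integral_mul_exp_Ioi {a : ℂ} (ha : a.re < 0) :
    ∫ s : ℝ in Ioi 0, (s : ℂ) * Complex.exp (a * s) = 1 / a ^ 2 := by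
  have ha0 : a ≠ 0 := by
    rintro rfl
    simp at ha
  have hnorm : ∀ s : ℝ, ‖Complex.exp (a * s)‖ = Real.exp (-(-a.re) * s) := fun s => by
    rw [Complex.norm_exp]
    simp
  have hderiv : ∀ s ∈ Ici (0 : ℝ), HasDerivAt
      (fun s : ℝ => ((s : ℂ) / a - 1 / a ^ 2) * Complex.exp (a * s))
      ((s : ℂ) * Complex.exp (a * s)) s := by
    intro s _
    have h0 := Complex.ofRealCLM.hasDerivAt (x := s)
    have h1 := (h0.div_const a).sub_const (1 / a ^ 2)
    have h2 := (h0.const_mul a).cexp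
    refine (h1.mul h2).congr_deriv ?_
    simp only [Complex.ofRealCLM_apply, Complex.ofReal_one]
    field_simp
    ring
  have hint : IntegrableOn (fun s : ℝ => (s : ℂ) * Complex.exp (a * s)) (Ioi 0) := by
    refine (integrableOn_mul_exp_neg (a := -a.re) (by linarith)).mono'
      (by fun_prop : Continuous _).aestronglyMeasurable ?_
    refine (ae_restrict_iff' measurableSet_Ioi).2 (Eventually.of_forall fun s hs => ?_)
    rw [norm_mul, Complex.norm_real, Real.norm_of_nonneg (le_of_lt hs), hnorm]
  have hlim : Tendsto (fun s : ℝ => ((s : ℂ) / a - 1 / a ^ 2) * Complex.exp (a * s)) atTop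
      (𝓝 0) := by
    have h1 : Tendsto (fun s : ℝ => (s : ℂ) * Complex.exp (a * s)) atTop (𝓝 0) := by
      rw [tendsto_zero_iff_norm_tendsto_zero]
      have h := Real.tendsto_pow_mul_exp_neg_atTop_nhds_zero 1
      have h' := (h.comp (tendsto_id.const_mul_atTop (neg_pos.2 ha))).const_mul (-a.re)⁻¹
      rw [mul_zero] at h'
      refine h'.congr' ?_
      filter_upwards [eventually_ge_atTop 0] with s hs
      rw [norm_mul, Complex.norm_real, Real.norm_of_nonneg hs, hnorm]
      simp only [Function.comp, id, pow_one]
      have : -a.re ≠ 0 := by linarith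
      rw [neg_mul (-a.re), ← mul_assoc, ← mul_assoc, inv_mul_cancel₀ this, one_mul]
    have h2 : Tendsto (fun s : ℝ => Complex.exp (a * s)) atTop (𝓝 0) := by
      rw [tendsto_zero_iff_norm_tendsto_zero]
      simp only [hnorm]
      refine Real.tendsto_exp_atBot.comp ?_
      exact tendsto_id.const_mul_atTop_of_neg (by linarith)
    have h := (h1.div_const a).sub (h2.const_mul (1 / a ^ 2))
    simp only [zero_div, mul_zero, sub_zero] at h
    refine h.congr fun s => ?_
    ring
  rw [integral_Ioi_of_hasDerivAt_of_tendsto' hderiv hint hlim]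
  simp

theorem line_ne_zero {v : ℝ} (hv0 : 0 < v) (x : ℝ) : (x : ℂ) + v * Complex.I ≠ 0 := by
  intro h
  have := congrArg Complex.im h
  simp at this
  exact hv0.ne' this

theorem le_norm_line {v : ℝ} (hv0 : 0 < v) (x : ℝ) : v ≤ ‖(x : ℂ) + v * Complex.I‖ := by
  have h := Complex.abs_im_le_norm ((x : ℂ) + v * Complex.I)
  simpa [abs_of_pos hv0] using h

/-- The weight s with c = -1 has Laplace transform 1/a² = -π²/y², where a = iy/π; it converges
because the line lies above the real axis, so Re a = -v/π < 0. -/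
theorem Li2_neg_exp_eq_integral_line {v : ℝ} (hv0 : 0 < v) (hv : v < Real.pi) {z : ℂ}
    (hz : |z.im| < Real.pi) :
    Li2 (-Complex.exp z) = Complex.I * Real.pi / 2 *
      ∫ x : ℝ, 1 / ((x : ℂ) + v * Complex.I) ^ 2 * expDivSinh z (x + v * Complex.I) := by
  have hpi : (Real.pi : ℂ) ≠ 0 := by exact_mod_cast Real.pi_ne_zero
  have hm : Continuous fun s : ℝ => (s : ℂ) := Complex.continuous_ofReal
  have hint : IntegrableOn
      (fun s : ℝ => ‖(s : ℂ)‖ * Real.exp (v * (-1) * s / Real.pi)) (Ioi 0) := by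
    refine (integrableOn_mul_exp_neg (div_pos hv0 Real.pi_pos)).congr_fun (fun s hs => ?_)
      measurableSet_Ioi
    simp only
    rw [Complex.norm_real, Real.norm_of_nonneg (le_of_lt hs)]
    congr 2
    ring
  have h := (integral_mul_logistic hv0 hv hz hm (-1) hint).2
  have hlap : ∀ x : ℝ, ∫ s : ℝ in Ioi 0, (s : ℂ) * Complex.exp
      (-Complex.I * (x + v * Complex.I) * ((-1 : ℝ) : ℂ) / Real.pi * s)
      = -Real.pi ^ 2 * (1 / ((x : ℂ) + v * Complex.I) ^ 2) := by
    intro x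
    rw [integral_mul_exp_Ioi]
    · have := line_ne_zero hv0 x
      rw [div_pow, mul_pow, mul_pow, neg_sq, Complex.I_sq]
      push_cast
      field_simp
    · rw [Complex.div_ofReal_re]
      refine div_neg_of_neg_of_pos ?_ Real.pi_pos
      simpa using hv0
  simp only [hlap, mul_assoc (-Real.pi ^ 2 : ℂ)] at h
  rw [integral_const_mul] at h
  rw [Li2_neg_exp_eq_integral hz]
  have h' : ∀ s : ℝ, z + ((-1 : ℝ) : ℂ) * s = z - s := fun s => by
    push_cast
    ring
  simp only [h'] at h
  rw [h]
  field_simp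

/-- The Laplace transform of one term of the Borel transform. -/
theorem laplace_logistic {v τ : ℝ} (hv0 : 0 < v) (hv : v < Real.pi) (hτ : 0 < τ)
    (hvτ : τ * v < Real.pi) {z : ℂ} (hz : |z.im| < Real.pi) {c : ℝ} (hc : |c| ≤ 1) :
    (Integrable fun x : ℝ => 1 / (1 / τ + Complex.I * (x + v * Complex.I) * c / Real.pi)
      * expDivSinh z (x + v * Complex.I)) ∧
    ∫ ξ : ℝ in Ioi 0, Complex.exp (-(ξ : ℂ) / τ) * logistic (z + c * ξ) =
      Complex.I / (2 * Real.pi) *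
        ∫ x : ℝ, 1 / (1 / τ + Complex.I * (x + v * Complex.I) * c / Real.pi)
          * expDivSinh z (x + v * Complex.I) := by
  -- Convergence at infinity: the decay e^(-ξ/τ) must beat the growth e^(vcξ/π), which is where τv <
  -- π enters.
  have hvc : v * c / Real.pi < 1 / τ := by
    rw [div_lt_div_iff₀ Real.pi_pos hτ]
    have : v * c ≤ v := by nlinarith [le_abs_self c]
    nlinarith
  have hm : Continuous fun ξ : ℝ => Complex.exp (-(ξ : ℂ) / τ) := by fun_prop
  have hint : IntegrableOn
      (fun ξ : ℝ => ‖Complex.exp (-(ξ : ℂ) / τ)‖ * Real.exp (v * c * ξ / Real.pi)) (Ioi 0) := by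
    refine (integrableOn_exp_mul_Ioi (a := v * c / Real.pi - 1 / τ) (by linarith) 0).congr_fun
      (fun ξ _ => ?_) measurableSet_Ioi
    simp only
    rw [Complex.norm_exp, ← Real.exp_add, Complex.div_ofReal_re]
    congr 1
    simp only [Complex.neg_re, Complex.ofReal_re]
    ring
  have hlap : ∀ x : ℝ, ∫ ξ : ℝ in Ioi 0, Complex.exp (-(ξ : ℂ) / τ) * Complex.exp
      (-Complex.I * (x + v * Complex.I) * c / Real.pi * ξ)
      = 1 / (1 / τ + Complex.I * (x + v * Complex.I) * c / Real.pi) := by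
    intro x
    have hexp : ∀ ξ : ℝ, Complex.exp (-(ξ : ℂ) / τ) * Complex.exp
        (-Complex.I * (x + v * Complex.I) * c / Real.pi * ξ)
        = Complex.exp (-(1 / τ + Complex.I * (x + v * Complex.I) * c / Real.pi) * ξ) := by
      intro ξ
      rw [← Complex.exp_add]
      congr 1
      ring
    simp only [hexp]
    rw [integral_exp_mul_complex_Ioi]
    · rw [Complex.ofReal_zero, mul_zero, Complex.exp_zero, neg_div_neg_eq]
    · have h1 : (1 / (τ : ℂ)).re = 1 / τ := by
        rw [← Complex.ofReal_one, ← Complex.ofReal_div, Complex.ofReal_re]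
      rw [Complex.neg_re, Complex.add_re, h1, Complex.div_ofReal_re]
      simp
      have : -(v * c) / Real.pi = -(v * c / Real.pi) := neg_div _ _
      rw [one_div] at hvc
      linarith
  have h := integral_mul_logistic hv0 hv hz hm c hint
  simp only [hlap] at h
  exact h

/-- The real part is τ²(x² - v²) + π²(n+1)². The bound is uniform in x and quadratic in n, which
justifies integrating the partial fractions termwise. -/
theorem norm_sq_add_ge (v τ x : ℝ) (n : ℕ) :
    (Real.pi ^ 2 - (τ * v) ^ 2) * ((n : ℝ) + 1) ^ 2
      ≤ ‖(τ * ((x : ℂ) + v * Complex.I)) ^ 2 + Real.pi ^ 2 * ((n : ℂ) + 1) ^ 2‖ := by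
  refine le_trans ?_ (Complex.re_le_norm _)
  have h : ((τ * ((x : ℂ) + v * Complex.I)) ^ 2 + Real.pi ^ 2 * ((n : ℂ) + 1) ^ 2).re
      = τ ^ 2 * (x ^ 2 - v ^ 2) + Real.pi ^ 2 * ((n : ℝ) + 1) ^ 2 := by
    have h1 : (τ * ((x : ℂ) + v * Complex.I)) ^ 2 + Real.pi ^ 2 * ((n : ℂ) + 1) ^ 2
        = ((τ ^ 2 * (x ^ 2 - v ^ 2) + Real.pi ^ 2 * ((n : ℝ) + 1) ^ 2 : ℝ) : ℂ)
          + ((2 * τ ^ 2 * x * v : ℝ) : ℂ) * Complex.I := by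
      push_cast
      linear_combination (τ ^ 2 * v ^ 2 : ℂ) * Complex.I_sq
    rw [h1]
    simp only [Complex.add_re, Complex.ofReal_re, Complex.re_ofReal_mul, Complex.I_re, mul_zero,
      add_zero]
  rw [h]
  have hn : (1 : ℝ) ≤ ((n : ℝ) + 1) ^ 2 :=
    one_le_pow₀ (by linarith [(Nat.cast_nonneg n : (0 : ℝ) ≤ n)])
  nlinarith [sq_nonneg (τ * x), mul_le_mul_of_nonneg_left hn (sq_nonneg (τ * v))]

theorem sq_add_ne_zero {v τ : ℝ} (hv0 : 0 < v) (hτ : 0 < τ) (hvτ : τ * v < Real.pi) (x : ℝ)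
    (n : ℕ) : (τ * ((x : ℂ) + v * Complex.I)) ^ 2 + Real.pi ^ 2 * ((n : ℂ) + 1) ^ 2 ≠ 0 := by
  intro h
  have h1 := norm_sq_add_ge v τ x n
  rw [h, norm_zero] at h1
  have h2 : 0 < Real.pi ^ 2 - (τ * v) ^ 2 := by
    have : 0 < τ * v := by positivity
    nlinarith
  have h3 : 0 < (Real.pi ^ 2 - (τ * v) ^ 2) * ((n : ℝ) + 1) ^ 2 := by positivity
  linarith

theorem integrableOn_exp_neg_div {τ : ℝ} (hτ : 0 < τ) :
    IntegrableOn (fun ξ : ℝ => Real.exp (-ξ / τ)) (Ioi 0) := by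
  refine (integrableOn_exp_mul_Ioi (a := -(1 / τ)) (by simpa using hτ) 0).congr_fun
    (fun ξ _ => ?_) measurableSet_Ioi
  simp only
  congr 1
  ring

theorem norm_exp_neg_div (ξ τ : ℝ) :
    ‖Complex.exp (-(ξ : ℂ) / τ)‖ = Real.exp (-ξ / τ) := by
  rw [Complex.norm_exp, Complex.div_ofReal_re, Complex.neg_re, Complex.ofReal_re]

theorem continuous_logistic_line {z : ℂ} (hz : |z.im| < Real.pi) (c : ℝ) :
    Continuous fun ξ : ℝ => logistic (z + c * ξ) := by
  refine continuous_iff_continuousAt.2 fun ξ => ?_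
  exact ContinuousAt.comp (f := fun ξ : ℝ => z + c * (ξ : ℂ)) (g := logistic)
    (differentiableAt_logistic (by simpa using hz)).continuousAt (by fun_prop)

theorem integrableOn_exp_mul_logistic {τ : ℝ} (hτ : 0 < τ) {z : ℂ} (hz : |z.im| < Real.pi)
    (c : ℝ) :
    IntegrableOn (fun ξ : ℝ => Complex.exp (-(ξ : ℂ) / τ) * logistic (z + c * ξ)) (Ioi 0) := by
  obtain ⟨θ, hθ1, hθ0, hθ⟩ := exists_strip hz
  refine ((integrableOn_exp_neg_div hτ).mul_const (Real.sin θ)⁻¹).mono'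
    (Continuous.aestronglyMeasurable
      ((by fun_prop : Continuous fun ξ : ℝ => Complex.exp (-(ξ : ℂ) / τ)).mul
        (continuous_logistic_line hz c)))
    (Eventually.of_forall fun ξ => ?_)
  rw [norm_mul, norm_exp_neg_div]
  gcongr
  exact norm_logistic_le (by simpa using hθ1.le) hθ0 hθ

/-- The Laplace integral of the symmetrised term of index `n`. -/
theorem laplace_borelTerm {v τ : ℝ} (hv0 : 0 < v) (hv : v < Real.pi) (hτ : 0 < τ)
    (hvτ : τ * v < Real.pi) {z : ℂ} (hz : |z.im| < Real.pi) (n : ℕ) :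
    1 / (2 * Real.pi * Complex.I) * ∫ ξ : ℝ in Ioi 0, Complex.exp (-(ξ : ℂ) / τ) *
        ((-1) ^ (n + 1) / ((n : ℂ) + 1) ^ 2
          * (logistic (z + ξ / (n + 1)) + logistic (z - ξ / (n + 1)))) =
      ∫ x : ℝ, expDivSinh z (x + v * Complex.I) *
        ((-1) ^ (n + 1) * (τ / 2 /
          ((τ * ((x : ℂ) + v * Complex.I)) ^ 2 + Real.pi ^ 2 * ((n : ℂ) + 1) ^ 2))) := by
  have hpi : (Real.pi : ℂ) ≠ 0 := by exact_mod_cast Real.pi_ne_zero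
  have hτ0 : (τ : ℂ) ≠ 0 := by exact_mod_cast hτ.ne'
  have hn0 : (n : ℂ) + 1 ≠ 0 := Nat.cast_add_one_ne_zero n
  set c : ℝ := 1 / ((n : ℝ) + 1) with hc
  have hcC : (c : ℂ) = 1 / ((n : ℂ) + 1) := by
    rw [hc]
    push_cast
    rfl
  have hc1 : |c| ≤ 1 := by
    rw [hc, abs_of_pos (by positivity), div_le_one (by positivity)]
    linarith [(Nat.cast_nonneg n : (0 : ℝ) ≤ n)]
  obtain ⟨hi1, he1⟩ := laplace_logistic hv0 hv hτ hvτ hz hc1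
  obtain ⟨hi2, he2⟩ := laplace_logistic hv0 hv hτ hvτ hz (c := -c) (by rwa [abs_neg])
  have hsplit : ∀ ξ : ℝ, Complex.exp (-(ξ : ℂ) / τ) * ((-1) ^ (n + 1) / ((n : ℂ) + 1) ^ 2
      * (logistic (z + ξ / (n + 1)) + logistic (z - ξ / (n + 1))))
      = (-1) ^ (n + 1) / ((n : ℂ) + 1) ^ 2 *
        (Complex.exp (-(ξ : ℂ) / τ) * logistic (z + c * ξ)
          + Complex.exp (-(ξ : ℂ) / τ) * logistic (z + (-c : ℝ) * ξ)) := by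
    intro ξ
    have h1 : z + (ξ : ℂ) / (n + 1) = z + c * ξ := by
      rw [hcC]
      ring
    have h2 : z - (ξ : ℂ) / (n + 1) = z + (-c : ℝ) * ξ := by
      rw [Complex.ofReal_neg, hcC]
      ring
    rw [h1, h2]
    ring
  simp only [hsplit]
  rw [integral_const_mul, integral_add (integrableOn_exp_mul_logistic hτ hz c)
    (integrableOn_exp_mul_logistic hτ hz (-c)), he1, he2, ← mul_add, ← integral_add hi1 hi2,
    ← integral_const_mul, ← integral_const_mul, ← integral_const_mul]
  refine integral_congr_ae (Eventually.of_forall fun x => ?_)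
  simp only
  have hq := sq_add_ne_zero hv0 hτ hvτ x n
  generalize (x : ℂ) + v * Complex.I = y at hq ⊢
  generalize expDivSinh z y = E
  rw [Complex.ofReal_neg, hcC]
  -- The fractions for c and -c have denominators 1/τ ± iyc/π. In their sum the numerator is free of
  -- y, which leaves one partial fraction of 1/sinh(τy) divided by 4y.
  have hprod : (1 / (τ : ℂ) + Complex.I * y * (1 / ((n : ℂ) + 1)) / Real.pi)
      * (1 / (τ : ℂ) + Complex.I * y * -(1 / ((n : ℂ) + 1)) / Real.pi)
      = ((τ * y) ^ 2 + Real.pi ^ 2 * ((n : ℂ) + 1) ^ 2)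
        / (τ ^ 2 * Real.pi ^ 2 * ((n : ℂ) + 1) ^ 2) := by
    field_simp
    linear_combination (-(y ^ 2 * τ ^ 2) : ℂ) * Complex.I_sq
  have hne : (1 / (τ : ℂ) + Complex.I * y * (1 / ((n : ℂ) + 1)) / Real.pi)
      * (1 / (τ : ℂ) + Complex.I * y * -(1 / ((n : ℂ) + 1)) / Real.pi) ≠ 0 := by
    rw [hprod]
    exact div_ne_zero hq (by positivity)
  have hsum : 1 / (1 / (τ : ℂ) + Complex.I * y * (1 / ((n : ℂ) + 1)) / Real.pi)
      + 1 / (1 / (τ : ℂ) + Complex.I * y * -(1 / ((n : ℂ) + 1)) / Real.pi)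
      = 2 * τ * Real.pi ^ 2 * ((n : ℂ) + 1) ^ 2
        / ((τ * y) ^ 2 + Real.pi ^ 2 * ((n : ℂ) + 1) ^ 2) := by
    rw [one_div_add_one_div (left_ne_zero_of_mul hne) (right_ne_zero_of_mul hne), hprod]
    field_simp
    ring
  rw [← add_mul, hsum]
  field_simp

/-! ### The rescaled Faddeev integral and the Borel sum -/

theorem sin_le_norm_sinh_line {v τ : ℝ} (hv0 : 0 < v) (hτ : 0 < τ) (hvτ : τ * v < Real.pi)
    (x : ℝ) : Real.sin (τ * v) ≤ ‖Complex.sinh (τ * ((x : ℂ) + v * Complex.I))‖ := by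
  have h1 := sin_mul_cosh_le_norm_sinh (τ * x) (τ * v)
  have h2 := Real.sin_pos_of_pos_of_lt_pi (by positivity : 0 < τ * v) hvτ
  have h3 := Real.one_le_cosh (τ * x)
  have h4 : (τ : ℂ) * ((x : ℂ) + v * Complex.I)
      = ((τ * x : ℝ) : ℂ) + ((τ * v : ℝ) : ℂ) * Complex.I := by
    push_cast
    ring
  rw [h4]
  nlinarith

/-- The Faddeev integrand after the substitution `x = b y`. -/
def scaledIntegrand (τ : ℝ) (z y : ℂ) : ℂ :=
  expDivSinh z y * (1 / (4 * y * Complex.sinh (τ * y)))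

theorem integrable_scaledIntegrand {v τ : ℝ} (hv0 : 0 < v) (hv : v < Real.pi) (hτ : 0 < τ)
    (hvτ : τ * v < Real.pi) {z : ℂ} (hz : |z.im| < Real.pi) :
    Integrable fun x : ℝ => scaledIntegrand τ z (x + v * Complex.I) := by
  have hsin := Real.sin_pos_of_pos_of_lt_pi (by positivity : 0 < τ * v) hvτ
  have hge : ∀ x : ℝ, 4 * v * Real.sin (τ * v) ≤ ‖4 * ((x : ℂ) + v * Complex.I)
      * Complex.sinh (τ * ((x : ℂ) + v * Complex.I))‖ := by
    intro x
    rw [norm_mul, norm_mul, Complex.norm_ofNat]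
    have h1 := le_norm_line hv0 x
    have h2 := sin_le_norm_sinh_line hv0 hτ hvτ x
    gcongr
  have hpos : 0 < 4 * v * Real.sin (τ * v) := by positivity
  refine (integrable_expDivSinh_line hv0 hv hz).mul_bdd
    (c := (4 * v * Real.sin (τ * v))⁻¹) ?_ ?_
  · refine Continuous.aestronglyMeasurable (Continuous.div continuous_const ?_ fun x h => ?_)
    · exact Continuous.mul (by fun_prop) (Complex.continuous_sinh.comp (by fun_prop))
    · have := hge x
      rw [h, norm_zero] at this
      linarith
  · refine Eventually.of_forall fun x => ?_
    rw [norm_div, norm_one, one_div]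
    exact inv_anti₀ hpos (hge x)

theorem integrable_div_sq {v : ℝ} (hv0 : 0 < v) (hv : v < Real.pi) {z : ℂ}
    (hz : |z.im| < Real.pi) : Integrable fun x : ℝ =>
      1 / ((x : ℂ) + v * Complex.I) ^ 2 * expDivSinh z (x + v * Complex.I) := by
  refine (integrable_expDivSinh_line hv0 hv hz).bdd_mul (c := (v ^ 2)⁻¹) ?_ ?_
  · exact Continuous.aestronglyMeasurable (Continuous.div continuous_const (by fun_prop)
      fun x => pow_ne_zero 2 (line_ne_zero hv0 x))
  · refine Eventually.of_forall fun x => ?_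
    rw [norm_div, norm_one, one_div, norm_pow]
    exact inv_anti₀ (by positivity) (by have := le_norm_line hv0 x; gcongr)

theorem hasSum_scaledIntegrand {v τ : ℝ} (hv0 : 0 < v) (hτ : 0 < τ) (hvτ : τ * v < Real.pi)
    (z : ℂ) (x : ℝ) :
    HasSum (fun n : ℕ => expDivSinh z (x + v * Complex.I) *
        ((-1) ^ (n + 1) * (τ / 2 /
          ((τ * ((x : ℂ) + v * Complex.I)) ^ 2 + Real.pi ^ 2 * ((n : ℂ) + 1) ^ 2))))
      (scaledIntegrand τ z (x + v * Complex.I) - 1 / (4 * τ) *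
        (1 / ((x : ℂ) + v * Complex.I) ^ 2 * expDivSinh z (x + v * Complex.I))) := by
  have hτ0 : (τ : ℂ) ≠ 0 := by exact_mod_cast hτ.ne'
  have hy := line_ne_zero hv0 x
  have hs : Complex.sinh (τ * ((x : ℂ) + v * Complex.I)) ≠ 0 := by
    intro h
    have h1 := sin_le_norm_sinh_line hv0 hτ hvτ x
    have h2 := Real.sin_pos_of_pos_of_lt_pi (by positivity : 0 < τ * v) hvτ
    rw [h, norm_zero] at h1
    linarith
  have hq := sq_add_ne_zero hv0 hτ hvτ x
  unfold scaledIntegrand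
  generalize (x : ℂ) + v * Complex.I = y at *
  refine hasSum_of_eq ((hasSum_one_div_sinh hs).mul_left (expDivSinh z y / (4 * y)))
    (fun n => ?_) ?_
  · have := hq n
    field_simp
    ring
  · field_simp

/-- One series is summed in two ways: `hline` integrates the partial fractions along the line, and
`hlap` takes the Laplace integral of `borelFun` term by term. The terms agree by
`laplace_borelTerm`, so the sums do. The part 1/(4τy²) split off from the integrand gives the
dilogarithm. -/
theorem integral_scaledIntegrand {v τ : ℝ} (hv0 : 0 < v) (hv : v < Real.pi) (hτ : 0 < τ)
    (hvτ : τ * v < Real.pi) {z : ℂ} (hz : |z.im| < Real.pi) :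
    ∫ x : ℝ, scaledIntegrand τ z (x + v * Complex.I)
      = 1 / (2 * Real.pi * Complex.I * τ) * Li2 (-Complex.exp z)
        + ∫ ξ : ℝ in Ioi 0, Complex.exp (-(ξ : ℂ) / τ) * borelFun z ξ := by
  have hpi : (Real.pi : ℂ) ≠ 0 := by exact_mod_cast Real.pi_ne_zero
  have hτ0 : (τ : ℂ) ≠ 0 := by exact_mod_cast hτ.ne'
  have hE := integrable_expDivSinh_line hv0 hv hz
  have hgap : 0 < Real.pi ^ 2 - (τ * v) ^ 2 := by
    have : 0 < τ * v := by positivity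
    nlinarith
  have hline : HasSum (fun n : ℕ => ∫ x : ℝ, expDivSinh z (x + v * Complex.I) *
        ((-1) ^ (n + 1) * (τ / 2 /
          ((τ * ((x : ℂ) + v * Complex.I)) ^ 2 + Real.pi ^ 2 * ((n : ℂ) + 1) ^ 2))))
      (∫ x : ℝ, (scaledIntegrand τ z (x + v * Complex.I) - 1 / (4 * τ) *
        (1 / ((x : ℂ) + v * Complex.I) ^ 2 * expDivSinh z (x + v * Complex.I)))) := by
    refine hasSum_integral_of_dominated_convergence
      (fun n x => 1 / ((n : ℝ) + 1) ^ 2 * (‖expDivSinh z (x + v * Complex.I)‖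
        * (τ / 2 / (Real.pi ^ 2 - (τ * v) ^ 2))))
      (fun n => ?_) (fun n => Eventually.of_forall fun x => ?_)
      (Eventually.of_forall fun x => summable_one_div_add_one_sq.mul_right _) ?_
      (Eventually.of_forall fun x => hasSum_scaledIntegrand hv0 hτ hvτ z x)
    · refine Continuous.aestronglyMeasurable ((continuous_expDivSinh_line hv0 hv z).mul ?_)
      exact continuous_const.mul (Continuous.div continuous_const (by fun_prop)
        fun x => sq_add_ne_zero hv0 hτ hvτ x n)
    · have hge := norm_sq_add_ge v τ x n
      rw [norm_mul, norm_mul, norm_pow, norm_neg, norm_one, one_pow, one_mul, norm_div, norm_div,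
        Complex.norm_real, Real.norm_of_nonneg hτ.le, Complex.norm_ofNat]
      calc _ ≤ ‖expDivSinh z (x + v * Complex.I)‖
            * (τ / 2 / ((Real.pi ^ 2 - (τ * v) ^ 2) * ((n : ℝ) + 1) ^ 2)) := by gcongr
        _ = _ := by
          field_simp
    · simp only [tsum_mul_right]
      exact (hE.norm.mul_const _).const_mul _
  have hlap : HasSum (fun n : ℕ => 1 / (2 * Real.pi * Complex.I) *
        ∫ ξ : ℝ in Ioi 0, Complex.exp (-(ξ : ℂ) / τ) *
        ((-1) ^ (n + 1) / ((n : ℂ) + 1) ^ 2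
          * (logistic (z + ξ / (n + 1)) + logistic (z - ξ / (n + 1)))))
      (∫ ξ : ℝ in Ioi 0, Complex.exp (-(ξ : ℂ) / τ) * borelFun z ξ) := by
    obtain ⟨θ, hθ1, hθ0, hθ⟩ := exists_strip hz
    have hθξ : ∀ ξ : ℝ, |z.im| + |(ξ : ℂ).im| ≤ θ := fun ξ => by simpa using hθ1.le
    have h := hasSum_integral_of_dominated_convergence (μ := volume.restrict (Ioi (0 : ℝ)))
      (F := fun (n : ℕ) (ξ : ℝ) => Complex.exp (-(ξ : ℂ) / τ) *
        ((-1) ^ (n + 1) / ((n : ℂ) + 1) ^ 2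
          * (logistic (z + ξ / (n + 1)) + logistic (z - ξ / (n + 1)))))
      (fun n ξ => Real.exp (-ξ / τ) * (1 / ((n : ℝ) + 1) ^ 2 * (2 * (Real.sin θ)⁻¹)))
      (fun n => ?_) (fun n => Eventually.of_forall fun ξ => ?_)
      (Eventually.of_forall fun ξ => (summable_one_div_add_one_sq.mul_right _).mul_left _) ?_
      (Eventually.of_forall fun ξ => (summable_borelTerm hθ0 hθ (hθξ ξ)).hasSum.mul_left _)
    · have h' := h.mul_left (1 / (2 * Real.pi * Complex.I))
      refine hasSum_of_eq h' (fun n => rfl) ?_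
      rw [← integral_const_mul]
      simp only [borelFun]
      refine integral_congr_ae (Eventually.of_forall fun ξ => ?_)
      simp only
      rw [mul_left_comm]
    · have h1 := continuous_logistic_line hz (1 / ((n : ℝ) + 1))
      have h2 := continuous_logistic_line hz (-(1 / ((n : ℝ) + 1)))
      refine Continuous.aestronglyMeasurable (Continuous.mul (by fun_prop)
        (continuous_const.mul ((h1.congr fun ξ => ?_).add (h2.congr fun ξ => ?_))))
      · push_cast
        congr 1
        ring
      · push_cast
        congr 1
        ring
    · rw [norm_mul, norm_exp_neg_div]
      exact mul_le_mul_of_nonneg_left (norm_borelTerm_le hθ0 hθ (hθξ ξ) n) (Real.exp_pos _).le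
    · simp only [tsum_mul_left]
      exact (integrableOn_exp_neg_div hτ).mul_const _
  simp only [laplace_borelTerm hv0 hv hτ hvτ hz] at hlap
  have heq := hline.unique hlap
  rw [integral_sub (integrable_scaledIntegrand hv0 hv hτ hvτ hz)
    ((integrable_div_sq hv0 hv hz).const_mul _), integral_const_mul] at heq
  rw [← heq, Li2_neg_exp_eq_integral_line hv0 hv hz]
  field_simp
  ring

theorem isBorelSum_borelFun {τ : ℝ} (hτ : 0 < τ) {z : ℂ} (hz : |z.im| < Real.pi) :
    IsBorelSum (phiHat z) τ (∫ ξ : ℝ in Ioi 0, Complex.exp (-(ξ : ℂ) / τ) * borelFun z ξ) := by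
  obtain ⟨θ, hθ1, hθ0, hθ⟩ := exists_strip hz
  have hana := analyticOnNhd_borelFun (z := z) hθ0 hθ
  -- Any θ strictly between |Im z| and π gives a strip of half-width θ - |Im z| for the
  -- continuation.
  refine ⟨by simp [phiHat], borelFun z, θ - |z.im|, sub_pos.2 hθ1, hasFPowerSeriesAt_borelFun hz,
    hana.mono (halfStrip_subset _), ?_, rfl⟩
  have hcont : Continuous fun ξ : ℝ => borelFun z ξ :=
    hana.continuousOn.comp_continuous Complex.continuous_ofReal fun ξ => by simpa using hθ1
  refine Integrable.mono' ((integrableOn_exp_neg_div hτ).mul_const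
      (‖1 / (2 * Real.pi * Complex.I)‖ * ∑' n : ℕ, 1 / ((n : ℝ) + 1) ^ 2 * (2 * (Real.sin θ)⁻¹)))
    (Continuous.aestronglyMeasurable (Continuous.mul (by fun_prop) hcont))
    (Eventually.of_forall fun ξ => ?_)
  rw [norm_mul, norm_exp_neg_div]
  exact mul_le_mul_of_nonneg_left
    (norm_borelFun_le hθ0 hθ (by simpa using hθ1.le)) (Real.exp_pos _).le

theorem faddeevIntegrand_mul {b : ℝ} (hb : 0 < b) (z y : ℂ) :
    faddeevIntegrand b (z / (2 * Real.pi * b)) (b * y)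
      = (b : ℂ)⁻¹ * scaledIntegrand (b ^ 2) z y := by
  have hpi : (Real.pi : ℂ) ≠ 0 := by exact_mod_cast Real.pi_ne_zero
  have hb0 : (b : ℂ) ≠ 0 := by exact_mod_cast hb.ne'
  have h1 : -2 * Complex.I * (b * y) * (z / (2 * Real.pi * b)) = -Complex.I * y * z / Real.pi := by
    field_simp
  have h2 : (b : ℂ) * y * (b : ℂ)⁻¹ = y := by field_simp
  have h3 : (b : ℂ) * y * b = ((b ^ 2 : ℝ) : ℂ) * y := by
    push_cast
    ring
  rw [faddeevIntegrand, scaledIntegrand, expDivSinh, h1, h2, h3, div_mul_div_comm, ← one_div,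
    div_mul_div_comm]
  congr 1 <;> ring

end QuantumDilog

end

/-- For `τ > 0`, `b = √τ` and `|Im z| < π`, the Borel sum of `phiHat z` at `τ` is
`log Φ_b(z / (2πb)) - Li₂(-e^z) / (2πiτ)`, for every admissible contour `ℝ + iε`. -/
theorem corollary1p5 (τ b : ℝ) (hb : 0 < b) (hτ : b ^ 2 = τ) (z : ℂ) (hz : |z.im| < Real.pi)
    (ε : ℝ) (hε : 0 < ε) (hεb : ε < Real.pi * b) (hεb' : ε < Real.pi / b) :
    MeasureTheory.Integrable
        (fun x : ℝ => QuantumDilog.faddeevIntegrand b (z / (2 * Real.pi * b))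
          ((x : ℂ) + (ε : ℂ) * Complex.I)) ∧
      ∃ L : ℂ, QuantumDilog.IsBorelSum (QuantumDilog.phiHat z) τ L ∧
        QuantumDilog.logFaddeev b ε (z / (2 * Real.pi * b)) =
            1 / (2 * Real.pi * Complex.I * τ) * QuantumDilog.Li2 (-Complex.exp z) + L ∧
        QuantumDilog.faddeevPhi b ε (z / (2 * Real.pi * b)) =
            Complex.exp (1 / (2 * Real.pi * Complex.I * τ) * QuantumDilog.Li2 (-Complex.exp z) + L) := by
  have hτ0 : 0 < τ := hτ ▸ pow_pos hb 2
  have hb0 : (b : ℂ) ≠ 0 := by exact_mod_cast hb.ne'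
  -- The rescaled height is v = ε/b; the conditions ε < πb and ε < π/b become v < π and τv < π.
  have hv0 : 0 < ε / b := div_pos hε hb
  have hv : ε / b < Real.pi := (div_lt_iff₀ hb).2 hεb
  have hvτ : τ * (ε / b) < Real.pi := by
    rw [← hτ, show b ^ 2 * (ε / b) = ε * b by field_simp]
    exact (lt_div_iff₀ hb).1 hεb'
  have hline : ∀ x : ℝ, QuantumDilog.faddeevIntegrand b (z / (2 * Real.pi * b))
      ((x : ℂ) + (ε : ℂ) * Complex.I) = (b : ℂ)⁻¹ * QuantumDilog.scaledIntegrand τ z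
        (((b⁻¹ * x : ℝ) : ℂ) + ((ε / b : ℝ) : ℂ) * Complex.I) := by
    intro x
    rw [← hτ, ← QuantumDilog.faddeevIntegrand_mul hb]
    congr 1
    push_cast
    field_simp
  have hlog : QuantumDilog.logFaddeev b ε (z / (2 * Real.pi * b))
      = ∫ x : ℝ, QuantumDilog.scaledIntegrand τ z (x + ((ε / b : ℝ) : ℂ) * Complex.I) := by
    rw [QuantumDilog.logFaddeev]
    simp only [hline]
    -- The Jacobian b of x = by cancels the prefactor b⁻¹.
    rw [MeasureTheory.integral_const_mul, MeasureTheory.Measure.integral_comp_mul_left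
      (fun x : ℝ => QuantumDilog.scaledIntegrand τ z (x + ((ε / b : ℝ) : ℂ) * Complex.I)),
      inv_inv, abs_of_pos hb, Complex.real_smul, inv_mul_cancel_left₀ hb0]
  refine ⟨?_, _, QuantumDilog.isBorelSum_borelFun hτ0 hz, ?_⟩
  · simp only [hline]
    exact ((QuantumDilog.integrable_scaledIntegrand hv0 hv hτ0 hvτ hz).comp_mul_left'
      (inv_ne_zero hb.ne')).const_mul _
  · rw [QuantumDilog.faddeevPhi, hlog, QuantumDilog.integral_scaledIntegrand hv0 hv hτ0 hvτ hz]
    exact ⟨rfl, rfl⟩
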